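/- Let $G$ be a (finite-dimensional, real, smooth) Lie group with Lie algebra $\mathfrak g=T_eG$, let $X_1,\dots,X_n$ be a basis of $\mathfrak g$ with dual basis $\xi_1,\dots,\xi_n$, and let $\pi:T^*G\to G$ be the cotangent bundle. Write $\mu_g,\mu^g$ for left and right translation by $g$ ($\mu_g(h)=gh$, $\mu^g(h)=hg$). Let $L_j(g)=T_e(\mu_g)X_j$ and $R_j(g)=T_e(\mu^g)X_j$ be the left and right invariant vector fields, $\kappa^l_g=T_g(\mu_{g^{-1}})$, $\kappa^r_g=T_g(\mu^{g^{-1}}):T_gG\to\mathfrak g$ the left and right Maurer–Cartan forms with components $\kappa^{l}_j=\langle\xi_j,\kappa^{l}\rangle$, $\kappa^{r}_j=\langle\xi_j,\kappa^{r}\rangle$, and let $\zeta^l,\zeta^r:T^*G\to\mathfrak g^*$ be the moment maps $\zeta^l|_{T_g^*G}=((\kappa^r_g)^{-1})^*$, $\zeta^r|_{T^*_gG}=((\kappa^l_g)^{-1})^*$, with components $\zeta^{l}_j=\langle\zeta^{l},X_j\rangle$, $\zeta^{r}_j=\langle\zeta^{r},X_j\rangle$. Let $\Theta$ be the Liouville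 form on $T^*G$, $\Theta_\xi(\Xi)=\langle\xi,T\pi\,\Xi\rangle$, and $\omega=d\Theta$. For a local diffeomorphism $\varphi$ of $G$ let $T^*\varphi(\xi)=\xi\circ(T_g\varphi)^{-1}$ for $\xi\in T_g^*G$, and let $L^*_j=\frac{d}{dt}\big|_0T^*(\mathrm{Fl}^{L_j}_t)$ and $R^*_j=\frac{d}{dt}\big|_0T^*(\mathrm{Fl}^{R_j}_t)$ be the flow lifts to $T^*G$ of $L_j$ and $R_j$. Then $\omega$ is nondegenerate and the functions $\zeta^l_j,\zeta^r_j$ are smooth. The flow lifts $L^*_j,R^*_j$ exist, are smooth vector fields on $T^*G$, and satisfy $T\pi\circ L^*_j=L_j\circ\pi$, $T\pi\circ R^*_j=R_j\circ\pi$. They are the Hamiltonian vector fields of $\zeta^r_j$ and $\zeta^l_j$ respectively: $$-i_{L^*_j}\omega=d\zeta^r_j,\qquad -i_{R^*_j}\omega=d\zeta^l_j .$$ The vector fields $Z^l_j,Z^r_j$ on $T^*G$ determined by $-i_{Z^l_j}\omega=\pi^*\kappa^l_j$ and $-i_{Z^r_j}\omega=\pi^*\kappa^r_j$ are smooth and vertical,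 i.e. in the kernel of $T\pi$. Finally, the associated Poisson bivector $\Lambda=\omega^{-1}$, i.e. the bivector field with $\Lambda(i_v\omega,i_w\omega)=\omega(v,w)$ for all tangent vectors $v,w$ at a point of $T^*G$, is $$\Lambda=\frac12\sum_{i=1}^n\left(R^*_i\wedge Z^r_i+L^*_i\wedge Z^l_i\right),$$ where $(v\wedge w)(\alpha,\beta)=\alpha(v)\beta(w)-\alpha(w)\beta(v)$. -/

import Mathlib

open Set Bundle Manifold
open scoped Manifold ContDiff Topology

noncomputable section

namespace CotangentPoisson

section Manifolds

variable {E : Type*} [NormedAddCommGroup E] [NormedSpace ℝ E]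
  {H : Type*} [TopologicalSpace H] (I : ModelWithCorners ℝ E H)
  {M : Type*} [TopologicalSpace M] [ChartedSpace H M]

/-- The exterior derivative of a 1-form `α`, as the 2-form `dα(v, w)`, computed in the
preferred chart `φ` at `x`: if `a = (φ⁻¹)^* α` is the local representative, with
`a : E → E^*`, then `dα(v, w) = (D a(φ x) v') w' - (D a(φ x) w') v'` where
`v' = Tφ v`, `w' = Tφ w`. -/
def extDerivOne (α : Π x : M, TangentSpace I x →L[ℝ] ℝ) (x : M) :
    TangentSpace I x →L[ℝ] TangentSpace I x →L[ℝ] ℝ :=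
  let φ := extChartAt I x
  let a : E → E →L[ℝ] ℝ := fun y ↦
    (α (φ.symm y)).comp (mfderivWithin 𝓘(ℝ, E) I φ.symm (range I) y)
  let B : E →L[ℝ] E →L[ℝ] ℝ := fderivWithin ℝ a (range I) (φ x)
  let T : TangentSpace I x →L[ℝ] E := mfderiv I 𝓘(ℝ, E) φ x
  (ContinuousLinearMap.precomp ℝ T).comp ((B - B.flip).comp T)

/-- The differential of a real function, as a 1-form. -/
def differential (f : M → ℝ) (x : M) : TangentSpace I x →L[ℝ] ℝ :=
  mfderiv I 𝓘(ℝ, ℝ) f x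

/-- `X` is the Hamiltonian vector field of the generating function `f` for the 2-form `Ω`:
`-i_X Ω = df`. -/
def IsHamiltonianFor (Ω : Π x : M, TangentSpace I x →L[ℝ] TangentSpace I x →L[ℝ] ℝ)
    (X : Π x : M, TangentSpace I x) (f : M → ℝ) : Prop :=
  ∀ x, -(Ω x (X x)) = differential I f x

/-- The flow of a vector field: `flow X t x` is the value at time `t` of an integral curve of `X`
starting at `x` and defined on an open interval containing `0` and `t`
(and `x` if there is none). -/
def flow (X : Π x : M, TangentSpace I x) (t : ℝ) (x : M) : M :=
  open Classical in
  if h : ∃ γ : ℝ → M, γ 0 = x ∧ ∃ a b : ℝ, 0 ∈ Ioo a b ∧ t ∈ Ioo a b ∧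
      IsMIntegralCurveOn (I := I) γ X (Ioo a b)
  then h.choose t else x

variable (M) in
/-- The cotangent bundle `T^*M`. -/
abbrev Cotangent : Type _ :=
  TotalSpace (E →L[ℝ] ℝ) (fun x : M ↦ TangentSpace I x →L[ℝ] ℝ)

/-- The model with corners of the cotangent bundle. -/
abbrev cotModel : ModelWithCorners ℝ (E × (E →L[ℝ] ℝ)) (ModelProd H (E →L[ℝ] ℝ)) :=
  I.prod 𝓘(ℝ, E →L[ℝ] ℝ)

/-- The cotangent functor on (local) diffeomorphisms:
`T^*φ (ξ) = ξ ∘ (T_x φ)⁻¹ ∈ T^*_{φ x} M` for `ξ ∈ T^*_x M`. -/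
def cotangentMap (φ : M → M) (ξ : Cotangent I M) : Cotangent I M :=
  ⟨φ ξ.proj, ξ.snd.comp (mfderiv I I φ ξ.proj).inverse⟩

variable [IsManifold I 1 M]

/-- `V` is a smooth vector field on `M`. -/
def IsSmoothField (V : Π x : M, TangentSpace I x) : Prop :=
  ContMDiff I I.tangent ∞ (fun x ↦ (⟨x, V x⟩ : TangentBundle I M))

/-- The differential `T_ξ π : T_ξ(T^*M) → T_{π ξ} M` of the projection `π : T^*M → M`. -/
def tangentProj (ξ : Cotangent I M) :
    TangentSpace (cotModel I) ξ →L[ℝ] TangentSpace I ξ.proj :=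
  mfderiv (cotModel I) I (fun η : Cotangent I M ↦ η.proj) ξ

/-- The pullback `π^* α` of a 1-form on `M` to `T^*M`. -/
def pullbackForm (α : Π x : M, TangentSpace I x →L[ℝ] ℝ) (ξ : Cotangent I M) :
    TangentSpace (cotModel I) ξ →L[ℝ] ℝ :=
  (α ξ.proj).comp (tangentProj I ξ)

/-- The Liouville form `Θ_ξ(Ξ) = ⟨ξ, T π Ξ⟩`. -/
def liouvilleForm (ξ : Cotangent I M) : TangentSpace (cotModel I) ξ →L[ℝ] ℝ :=
  ξ.snd.comp (tangentProj I ξ)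

variable (M) in
/-- The canonical 2-form `ω = dΘ` on `T^*M`; `symplecticForm I M ξ v` is `i_v ω`, so that
`symplecticForm I M ξ` is also the map `T_ξ(T^*M) → T_ξ^*(T^*M)`, `v ↦ i_v ω`. -/
def symplecticForm (ξ : Cotangent I M) :
    TangentSpace (cotModel I) ξ →L[ℝ] TangentSpace (cotModel I) ξ →L[ℝ] ℝ :=
  extDerivOne (cotModel I) (fun η : Cotangent I M ↦ liouvilleForm I η) ξ

/-- The vector `ω⁻¹ β`, i.e. the vector `v` with `i_v ω = β` (`ω` being nondegenerate). -/
def symplecticDual (ξ : Cotangent I M) (β : TangentSpace (cotModel I) ξ →L[ℝ] ℝ) :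
    TangentSpace (cotModel I) ξ :=
  (symplecticForm I M ξ).inverse β

/-- The bivector `Λ = ω⁻¹`, as a skew form on covectors: the form obtained from `ω` by
transport along `v ↦ i_v ω`, i.e. `Λ(i_v ω, i_w ω) = ω(v, w)`. -/
def poissonBivector (ξ : Cotangent I M) (α β : TangentSpace (cotModel I) ξ →L[ℝ] ℝ) : ℝ :=
  symplecticForm I M ξ (symplecticDual I ξ α) (symplecticDual I ξ β)

/-- The flow lift `X^*` of a vector field `X` on `M` to `T^*M`:
`X^*(ξ) = d/dt|₀ T^*(Fl^X_t)(ξ)`. The curve passes through `ξ` at time `0`. -/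
def flowLift (X : Π x : M, TangentSpace I x) (ξ : Cotangent I M) :
    TangentSpace (cotModel I) ξ :=
  mfderiv 𝓘(ℝ, ℝ) (cotModel I) (fun t : ℝ ↦ cotangentMap I (flow I X t) ξ) 0 (1 : ℝ)

/-- The flow lift of `X` exists: for each `ξ`, the curve `t ↦ T^*(Fl^X_t)(ξ)` passes through `ξ`
at time `0` and is differentiable there. -/
def HasFlowLift (X : Π x : M, TangentSpace I x) : Prop :=
  ∀ ξ : Cotangent I M, cotangentMap I (flow I X 0) ξ = ξ ∧
    MDifferentiableAt 𝓘(ℝ, ℝ) (cotModel I) (fun t : ℝ ↦ cotangentMap I (flow I X t) ξ) 0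

end Manifolds

/-- The bivector `v ∧ w`, as a skew form on covectors:
`(v ∧ w)(α, β) = α(v) β(w) - α(w) β(v)`. -/
def wedge {V : Type*} [AddCommGroup V] [Module ℝ V] [TopologicalSpace V] (v w : V)
    (α β : V →L[ℝ] ℝ) : ℝ :=
  α v * β w - α w * β v

section LieGroups

variable {E : Type*} [NormedAddCommGroup E] [NormedSpace ℝ E]
  {H : Type*} [TopologicalSpace H] (I : ModelWithCorners ℝ E H)
  {G : Type*} [TopologicalSpace G] [ChartedSpace H G] [Group G]

/-- The left invariant vector field `L_X(g) = T_e(μ_g) X`. -/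
def leftField (X : GroupLieAlgebra I G) (g : G) : TangentSpace I g :=
  mulInvariantVectorField X g

/-- The right invariant vector field `R_X(g) = T_e(μ^g) X`. -/
def rightField (X : GroupLieAlgebra I G) (g : G) : TangentSpace I g :=
  mfderiv I I (fun h : G ↦ h * g) (1 : G) X

/-- The left Maurer-Cartan form `κ^l_g = T_g(μ_{g⁻¹}) : T_g G → 𝔤`. -/
def leftMaurerCartan (g : G) : TangentSpace I g →L[ℝ] GroupLieAlgebra I G :=
  mfderiv I I (fun h : G ↦ g⁻¹ * h) g

/-- The right Maurer-Cartan form `κ^r_g = T_g(μ^{g⁻¹}) : T_g G → 𝔤`. -/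
def rightMaurerCartan (g : G) : TangentSpace I g →L[ℝ] GroupLieAlgebra I G :=
  mfderiv I I (fun h : G ↦ h * g⁻¹) g

/-- The left moment map `ζ^l_g = ((κ^r_g)⁻¹)^* : T_g^* G → 𝔤^*`. -/
def leftMoment (ξ : Cotangent I G) : GroupLieAlgebra I G →L[ℝ] ℝ :=
  ξ.snd.comp (rightMaurerCartan I ξ.proj).inverse

/-- The right moment map `ζ^r_g = ((κ^l_g)⁻¹)^* : T_g^* G → 𝔤^*`. -/
def rightMoment (ξ : Cotangent I G) : GroupLieAlgebra I G →L[ℝ] ℝ :=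
  ξ.snd.comp (leftMaurerCartan I ξ.proj).inverse

section Basis

variable [FiniteDimensional ℝ E] {n : ℕ} (X : Module.Basis (Fin n) ℝ (GroupLieAlgebra I G))

/-- The dual basis vector `ξ_j ∈ 𝔤^*` of a basis `X` of `𝔤`. -/
def dualVector (j : Fin n) : GroupLieAlgebra I G →L[ℝ] ℝ :=
  haveI : FiniteDimensional ℝ (GroupLieAlgebra I G) := inferInstanceAs (FiniteDimensional ℝ E)
  haveI : T2Space (GroupLieAlgebra I G) := inferInstanceAs (T2Space E)
  LinearMap.toContinuousLinearMap (X.coord j)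

/-- The component `κ^l_j = ⟨ξ_j, κ^l⟩` of the left Maurer-Cartan form. -/
def leftMaurerCartanCoord (j : Fin n) (g : G) : TangentSpace I g →L[ℝ] ℝ :=
  (dualVector I X j).comp (leftMaurerCartan I g)

/-- The component `κ^r_j = ⟨ξ_j, κ^r⟩` of the right Maurer-Cartan form. -/
def rightMaurerCartanCoord (j : Fin n) (g : G) : TangentSpace I g →L[ℝ] ℝ :=
  (dualVector I X j).comp (rightMaurerCartan I g)

/-- The component `ζ^l_j = ⟨ζ^l, X_j⟩` of the left moment map. -/
def leftMomentCoord (j : Fin n) (ξ : Cotangent I G) : ℝ := leftMoment I ξ (X j)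

/-- The component `ζ^r_j = ⟨ζ^r, X_j⟩` of the right moment map. -/
def rightMomentCoord (j : Fin n) (ξ : Cotangent I G) : ℝ := rightMoment I ξ (X j)

variable [IsManifold I 1 G]

/-- The flow lift `L^*_j` of the left invariant field `L_j = L_{X_j}`. -/
def leftLift (j : Fin n) (ξ : Cotangent I G) : TangentSpace (cotModel I) ξ :=
  flowLift I (leftField I (X j)) ξ

/-- The flow lift `R^*_j` of the right invariant field `R_j = R_{X_j}`. -/
def rightLift (j : Fin n) (ξ : Cotangent I G) : TangentSpace (cotModel I) ξ :=
  flowLift I (rightField I (X j)) ξ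

/-- The field `Z^l_j`, `ω`-dual to `-π^* κ^l_j`, i.e. `-i_{Z^l_j} ω = π^* κ^l_j`. -/
def leftDualField (j : Fin n) (ξ : Cotangent I G) : TangentSpace (cotModel I) ξ :=
  symplecticDual I ξ (-(pullbackForm I (leftMaurerCartanCoord I X j) ξ))

/-- The field `Z^r_j`, `ω`-dual to `-π^* κ^r_j`, i.e. `-i_{Z^r_j} ω = π^* κ^r_j`. -/
def rightDualField (j : Fin n) (ξ : Cotangent I G) : TangentSpace (cotModel I) ξ :=
  symplecticDual I ξ (-(pullbackForm I (rightMaurerCartanCoord I X j) ξ))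

end Basis

end LieGroups

end CotangentPoisson

end

open CotangentPoisson

/-! In a cotangent chart `(q, p)` the Liouville form is `p dq`, so `ω` is the constant form `((q,
p), (q', p')) ↦ p q' - p' q` (`symplecticForm_apply`). It is nondegenerate by a dimension count, and
because it is constant in every cotangent chart, a field `V` is smooth as soon as `i_V ω` is.

Left and right are treated together through `IsSmoothTranslation`. A multiplication `a` yields the
fields `V_X(x) = T_e(h ↦ a h x) X`, the form `κ` with `κ(V_X) = X`, and the functions `⟨ξ, V_X⟩`.
Taking `a h x = h * x` gives the right invariant fields, `κ^r` and `ζ^l`; the opposite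
multiplication gives the left invariant fields, `κ^l` and `ζ^r`.

By associativity the flow of `V_X` is `x ↦ a (γ t) x` for small `t`, where `γ` is the integral curve
through `1`. Differentiating its cotangent lift in a chart gives `(V_X(q), -p ∘ DV_X(q))`
(`flowLift_translationField_aux`), which is the Hamiltonian field of `(q, p) ↦ p(V_X(q))`.

For the bivector, evaluate on `i_v ω` and `i_w ω`, and write `v₁`, `w₁` for base components.
Expanding in the basis, the wedges for one multiplication sum to `ω(v, w) + p(DV_{κ(w₁)} v₁ -
DV_{κ(v₁)} w₁)` (`sum_wedge_flowLift_translationDual`). Left and right translations commute, hence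
`DV_X(V'_Y) = DV'_Y(V_X)` (`fieldDeriv_translationField_of_commute`). This makes the two error terms
opposite, so both families together give `2ω`; hence the factor `1/2`. -/

noncomputable section

namespace CotangentPoisson

/-! ### Smoothness and derivatives read in charts of a manifold. -/

section Charts

variable {F : Type*} [NormedAddCommGroup F] [NormedSpace ℝ F]
    {H : Type*} [TopologicalSpace H] {I : ModelWithCorners ℝ F H}
    {N : Type*} [TopologicalSpace N] [ChartedSpace H N]

/-- The trivialization of the tangent bundle at `x₀` is the derivative of the chart at `x₀`, so `f`
is the local coordinate expression of the section. -/
theorem isSmoothField_of_chart [IsManifold I ∞ N] {V : Π x : N, TangentSpace I x}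
    (h : ∀ x₀, ∃ f : N → F, ContMDiffAt I 𝓘(ℝ, F) ∞ f x₀ ∧ ∀ x ∈ (chartAt H x₀).source,
      mfderiv I 𝓘(ℝ, F) (extChartAt I x₀) x (V x) = f x) :
    IsSmoothField I V := by
  intro x₀
  obtain ⟨f, hf, hV⟩ := h x₀
  refine (contMDiffAt_section x₀).2 (hf.congr_of_eventuallyEq ?_)
  filter_upwards [(chartAt H x₀).open_source.mem_nhds (mem_chart_source H x₀)] with x hx
  have hA := TangentBundle.continuousLinearMapAt_trivializationAt hx (I := I)
  refine Eq.trans ?_ ((DFunLike.congr_fun hA (V x)).trans (hV x hx))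
  exact (congrFun (Trivialization.coe_linearMapAt_of_mem (R := ℝ)
    (trivializationAt F (TangentSpace I) x₀) (by simpa using hx)) (V x)).symm

variable [I.Boundaryless]

theorem contMDiffAt_extChartAt_symm_of_boundaryless [IsManifold I ∞ N] {x : N} {y : F}
    (hy : y ∈ (extChartAt I x).target) :
    ContMDiffAt 𝓘(ℝ, F) I ∞ (extChartAt I x).symm y :=
  (contMDiffOn_extChartAt_symm x).contMDiffAt
    (extChartAt_target_mem_nhds' (by simpa using hy))

theorem contDiffAt_chart_transition [IsManifold I ∞ N] {x₀ x : N} {y : F}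
    (hy : y ∈ (extChartAt I x).target)
    (h : (extChartAt I x).symm y ∈ (chartAt H x₀).source) :
    ContDiffAt ℝ ∞ (extChartAt I x₀ ∘ (extChartAt I x).symm) y :=
  ((contMDiffAt_extChartAt' h).comp y
    (contMDiffAt_extChartAt_symm_of_boundaryless hy)).contDiffAt

theorem fderiv_chart_transition [IsManifold I 1 N] {x₀ x : N} {y : F}
    (hy : y ∈ (extChartAt I x).target)
    (h : (extChartAt I x).symm y ∈ (chartAt H x₀).source) :
    fderiv ℝ (extChartAt I x₀ ∘ (extChartAt I x).symm) y =
      (mfderiv I 𝓘(ℝ, F) (extChartAt I x₀) ((extChartAt I x).symm y)).comp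
        (mfderivWithin 𝓘(ℝ, F) I (extChartAt I x).symm (range I) y) := by
  have h1 := mdifferentiableWithinAt_extChartAt_symm (I := I) hy
  rw [I.range_eq_univ, mdifferentiableWithinAt_univ] at h1
  rw [I.range_eq_univ, mfderivWithin_univ, ← mfderiv_eq_fderiv]
  exact mfderiv_comp y (mdifferentiableAt_extChartAt h) h1

theorem fderiv_chart_transition_self [IsManifold I 1 N] {x₀ x : N}
    (h : x ∈ (chartAt H x₀).source) :
    fderiv ℝ (extChartAt I x₀ ∘ (extChartAt I x).symm) (extChartAt I x x) =
      (mfderiv I 𝓘(ℝ, F) (extChartAt I x₀) x : F →L[ℝ] F) := by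
  rw [fderiv_chart_transition (mem_extChartAt_target x) (by simpa using h),
    mfderivWithin_range_extChartAt_symm, extChartAt_to_inv]
  rfl

theorem mfderiv_eq_fderiv_comp_symm {F' : Type*} [NormedAddCommGroup F'] [NormedSpace ℝ F']
    {f : N → F'} {x : N} (hf : MDifferentiableAt I 𝓘(ℝ, F') f x) :
    (mfderiv I 𝓘(ℝ, F') f x : F →L[ℝ] F') =
      fderiv ℝ (f ∘ (extChartAt I x).symm) (extChartAt I x x) := by
  rw [hf.mfderiv, I.range_eq_univ, fderivWithin_univ]
  rfl

/-- `TangentSpace I x` is the model space through the preferred chart at `x`, whose derivative at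
`x` is the identity; the coordinate velocity is therefore the velocity itself. -/
theorem curve_of_hasDerivAt_chart [IsManifold I 1 N] {c : ℝ → N} {x : N} (h0 : c 0 = x)
    (hc : ∀ᶠ t in 𝓝 0, c t ∈ (extChartAt I x).source) {v : F}
    (hv : HasDerivAt (fun t ↦ extChartAt I x (c t)) v 0) :
    MDifferentiableAt 𝓘(ℝ, ℝ) I c 0 ∧ (mfderiv 𝓘(ℝ, ℝ) I c 0 (1 : ℝ) : F) = v := by
  subst h0
  have h1 := mdifferentiableWithinAt_extChartAt_symm (I := I)
    (mem_extChartAt_target (I := I) (c 0))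
  have hid := mfderivWithin_range_extChartAt_symm (I := I) (x := c 0)
  rw [I.range_eq_univ, mdifferentiableWithinAt_univ] at h1
  rw [I.range_eq_univ, mfderivWithin_univ] at hid
  have h2 : HasMFDerivAt 𝓘(ℝ, ℝ) I ((extChartAt I (c 0)).symm ∘ fun t ↦ extChartAt I (c 0) (c t))
      0 _ := h1.hasMFDerivAt.comp (0 : ℝ) hv.hasFDerivAt.hasMFDerivAt
  have h3 := h2.congr_of_eventuallyEq (f₁ := c) (by
    filter_upwards [hc] with t ht using ((extChartAt I (c 0)).left_inv ht).symm)
  refine ⟨h3.mdifferentiableAt, (DFunLike.congr_fun h3.mfderiv (1 : ℝ)).trans ?_⟩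
  exact (DFunLike.congr_fun hid ((1 : ℝ) • v)).trans (one_smul ℝ v)

theorem exists_contMDiffAt_differential_eq [IsManifold I ∞ N] {f : N → ℝ}
    (hf : ContMDiff I 𝓘(ℝ, ℝ) ∞ f) (x₀ : N) :
    ∃ b : N → F →L[ℝ] ℝ, ContMDiffAt I 𝓘(ℝ, F →L[ℝ] ℝ) ∞ b x₀ ∧
      ∀ x ∈ (chartAt H x₀).source,
        differential I f x = (b x).comp (mfderiv I 𝓘(ℝ, F) (extChartAt I x₀) x) := by
  have hg {y : F} (hy : y ∈ (extChartAt I x₀).target) :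
      ContDiffAt ℝ ∞ (f ∘ (extChartAt I x₀).symm) y :=
    (hf.contMDiffAt.comp y (contMDiffAt_extChartAt_symm_of_boundaryless hy)).contDiffAt
  refine ⟨fun x ↦ fderiv ℝ (f ∘ (extChartAt I x₀).symm) (extChartAt I x₀ x), ?_, fun x hx ↦ ?_⟩
  · exact ((hg (mem_extChartAt_target x₀)).fderiv_right (m := ∞) (by simp)).contMDiffAt.comp x₀
      contMDiffAt_extChartAt
  · have hs : x ∈ (extChartAt I x₀).source := by rwa [extChartAt_source]
    have h1 := (((hg ((extChartAt I x₀).map_source hs)).differentiableAt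
      (by simp)).hasFDerivAt.hasMFDerivAt).comp x (mdifferentiableAt_extChartAt hx).hasMFDerivAt
    refine (h1.congr_of_eventuallyEq (f₁ := f) ?_).mfderiv
    filter_upwards [extChartAt_source_mem_nhds' hs] with y hy
    exact congrArg f ((extChartAt I x₀).left_inv hy).symm

end Charts

/-! ### The Liouville form and the symplectic form in cotangent charts. -/

section CotangentCharts

variable {E : Type*} [NormedAddCommGroup E] [NormedSpace ℝ E]

local notation "𝓜" => modelWithCornersSelf ℝ E
local notation "𝓒" => cotModel (modelWithCornersSelf ℝ E)

variable
  {M : Type*} [TopologicalSpace M] [ChartedSpace E M] [IsManifold 𝓘(ℝ, E) ∞ M]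

theorem extChartAt_cotangent_apply {ξ₀ ξ : Cotangent 𝓜 M}
    (h : ξ.proj ∈ (chartAt E ξ₀.proj).source) :
    extChartAt 𝓒 ξ₀ ξ = (extChartAt 𝓜 ξ₀.proj ξ.proj,
      ξ.snd.comp (mfderivWithin 𝓜 𝓜 (extChartAt 𝓜 ξ₀.proj).symm
        (range 𝓜) (extChartAt 𝓜 ξ₀.proj ξ.proj))) := by
  rw [FiberBundle.extChartAt, PartialEquiv.trans_apply,
    ← TangentBundle.symmL_trivializationAt h]
  refine Prod.ext rfl ?_
  ext v
  simp [hom_trivializationAt_apply, ContinuousLinearMap.inCoordinates]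
  rfl

theorem mem_extChartAt_cotangent_source {ξ₀ ξ : Cotangent 𝓜 M} :
    ξ ∈ (extChartAt 𝓒 ξ₀).source ↔ ξ.proj ∈ (chartAt E ξ₀.proj).source := by
  rw [FiberBundle.extChartAt]
  simp [hom_trivializationAt_apply]

theorem snd_eq_chart_comp {ξ₀ ξ : Cotangent 𝓜 M}
    (h : ξ.proj ∈ (chartAt E ξ₀.proj).source) :
    ξ.snd = (extChartAt 𝓒 ξ₀ ξ).2.comp (mfderiv 𝓜 𝓜 (extChartAt 𝓜 ξ₀.proj) ξ.proj) := by
  have hs : ξ.proj ∈ (extChartAt 𝓜 ξ₀.proj).source := by rwa [extChartAt_source]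
  rw [extChartAt_cotangent_apply h]
  have := mfderivWithin_extChartAt_symm_comp_mfderiv_extChartAt' (I := 𝓜) hs
  ext v
  exact congrArg ξ.snd (DFunLike.congr_fun this v).symm

theorem mfderiv_chart_tangentProj {ξ₀ ξ : Cotangent 𝓜 M}
    (h : ξ.proj ∈ (chartAt E ξ₀.proj).source) (v : TangentSpace 𝓒 ξ) :
    mfderiv 𝓜 𝓜 (extChartAt 𝓜 ξ₀.proj) ξ.proj (tangentProj 𝓜 ξ v) =
      (mfderiv 𝓒 𝓘(ℝ, E × (E →L[ℝ] ℝ)) (extChartAt 𝓒 ξ₀) ξ v : E × (E →L[ℝ] ℝ)).1 := by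
  have hs : ξ ∈ (extChartAt 𝓒 ξ₀).source := mem_extChartAt_cotangent_source.2 h
  have hproj : MDifferentiableAt 𝓒 𝓜 (fun η : Cotangent 𝓜 M ↦ η.proj) ξ :=
    (Bundle.contMDiffAt_proj (n := 1) _).mdifferentiableAt one_ne_zero
  have h1 : HasMFDerivAt 𝓒 𝓜 (extChartAt 𝓜 ξ₀.proj ∘ fun η : Cotangent 𝓜 M ↦ η.proj) ξ _ :=
    (mdifferentiableAt_extChartAt h).hasMFDerivAt.comp ξ hproj.hasMFDerivAt
  have h2 : HasMFDerivAt 𝓒 𝓜 (Prod.fst ∘ extChartAt 𝓒 ξ₀) ξ _ :=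
    ((ContinuousLinearMap.fst ℝ E (E →L[ℝ] ℝ)).hasMFDerivAt).comp ξ
      (mdifferentiableAt_extChartAt (by rwa [← extChartAt_source (I := 𝓒)])).hasMFDerivAt
  have h3 : (extChartAt 𝓜 ξ₀.proj ∘ fun η : Cotangent 𝓜 M ↦ η.proj) =ᶠ[𝓝 ξ]
      Prod.fst ∘ extChartAt 𝓒 ξ₀ := by
    filter_upwards [extChartAt_source_mem_nhds' (I := 𝓒) hs] with η hη
    exact (congrArg Prod.fst
      (extChartAt_cotangent_apply (mem_extChartAt_cotangent_source.1 hη))).symm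
  have := hasMFDerivAt_unique h1 (h2.congr_of_eventuallyEq h3)
  exact DFunLike.congr_fun this v

theorem tangentProj_apply (ξ : Cotangent 𝓜 M) (v : TangentSpace 𝓒 ξ) :
    tangentProj 𝓜 ξ v = (show E × (E →L[ℝ] ℝ) from v).1 := by
  have := mfderiv_chart_tangentProj (mem_chart_source E ξ.proj) v
  rw [mfderiv_extChartAt_self, mfderiv_extChartAt_self] at this
  exact this

theorem liouvilleForm_apply {ξ₀ ξ : Cotangent 𝓜 M}
    (h : ξ.proj ∈ (chartAt E ξ₀.proj).source) (v : TangentSpace 𝓒 ξ) :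
    liouvilleForm 𝓜 ξ v = (extChartAt 𝓒 ξ₀ ξ).2
      (mfderiv 𝓒 𝓘(ℝ, E × (E →L[ℝ] ℝ)) (extChartAt 𝓒 ξ₀) ξ v : E × (E →L[ℝ] ℝ)).1 := by
  rw [← mfderiv_chart_tangentProj h]
  have := snd_eq_chart_comp h
  exact DFunLike.congr_fun this (tangentProj 𝓜 ξ v)

/-- The skew form `(v, w) ↦ B v w - B w v` of a bilinear form. -/
noncomputable def skewForm {F : Type*} [NormedAddCommGroup F] [NormedSpace ℝ F]
    (B : F →L[ℝ] F →L[ℝ] ℝ) : F →L[ℝ] F →L[ℝ] ℝ :=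
  B - B.flip

/-- The canonical skew form `((q, p), (q', p')) ↦ p q' - p' q` on `E × E^*`. -/
noncomputable def canonicalForm (E : Type*) [NormedAddCommGroup E] [NormedSpace ℝ E] :
    (E × (E →L[ℝ] ℝ)) →L[ℝ] (E × (E →L[ℝ] ℝ)) →L[ℝ] ℝ :=
  skewForm ((ContinuousLinearMap.precomp ℝ (ContinuousLinearMap.fst ℝ E (E →L[ℝ] ℝ))).comp
    (ContinuousLinearMap.snd ℝ E (E →L[ℝ] ℝ)))

/-- A local representative that is linear in the base point is its own derivative, and the preferred
chart contributes only an identity. -/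
theorem extDerivOne_eq_skewForm {F : Type*} [NormedAddCommGroup F] [NormedSpace ℝ F]
    {H : Type*} [TopologicalSpace H] (I : ModelWithCorners ℝ F H) [I.Boundaryless]
    {N : Type*} [TopologicalSpace N] [ChartedSpace H N] [IsManifold I 1 N]
    (α : Π x : N, TangentSpace I x →L[ℝ] ℝ) (x : N) (B : F →L[ℝ] F →L[ℝ] ℝ)
    (h : (fun y : F ↦ ((α ((extChartAt I x).symm y)).comp
      (mfderivWithin 𝓘(ℝ, F) I (extChartAt I x).symm (range I) y) : F →L[ℝ] ℝ))
      =ᶠ[𝓝 (extChartAt I x x)] B) :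
    extDerivOne I α x = skewForm B := by
  have hD := h.fderiv_eq.trans B.fderiv
  simp only [extDerivOne]
  rw [mfderiv_extChartAt_self]
  simp only [ModelWithCorners.range_eq_univ, fderivWithin_univ] at hD ⊢
  rw [hD]
  rfl

theorem symplecticForm_self (ξ : Cotangent 𝓜 M) :
    symplecticForm 𝓜 M ξ = canonicalForm E := by
  refine extDerivOne_eq_skewForm _ _ _ _ ?_
  filter_upwards [extChartAt_target_mem_nhds (I := 𝓒) ξ] with y hy
  have hs := mem_extChartAt_cotangent_source.1 ((extChartAt 𝓒 ξ).map_target hy)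
  have h1 := mfderiv_extChartAt_comp_mfderivWithin_extChartAt_symm (I := 𝓒) hy
  refine ContinuousLinearMap.ext fun w ↦ (liouvilleForm_apply hs _).trans ?_
  rw [(extChartAt 𝓒 ξ).right_inv hy]
  exact congrArg (fun z : E × (E →L[ℝ] ℝ) ↦ y.2 z.1) (DFunLike.congr_fun h1 w)

/-- This is `d τ^* = τ^* d` for the 1-form `y ↦ B y`, assumed to be `τ`-invariant near `y₀`.
Differentiating the invariance produces a term in the second derivative of `τ`, which is symmetric
and drops out of the skew part. -/
theorem skewForm_invariant {F : Type*} [NormedAddCommGroup F] [NormedSpace ℝ F]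
    {B : F →L[ℝ] F →L[ℝ] ℝ} {τ : F → F} {y₀ : F} (hτ : ContDiffAt ℝ 2 τ y₀)
    (h : ∀ᶠ y in 𝓝 y₀, ∀ w, B y w = B (τ y) (fderiv ℝ τ y w)) (v w : F) :
    skewForm B v w = skewForm B (fderiv ℝ τ y₀ v) (fderiv ℝ τ y₀ w) := by
  have hd : DifferentiableAt ℝ τ y₀ := hτ.differentiableAt two_ne_zero
  have hd2 : DifferentiableAt ℝ (fderiv ℝ τ) y₀ :=
    (hτ.fderiv_right (m := 1) (by norm_num)).differentiableAt one_ne_zero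
  have hsymm : IsSymmSndFDerivAt ℝ τ y₀ := hτ.isSymmSndFDerivAt (by simp)
  have key (v w : F) : B v w = B (fderiv ℝ τ y₀ v) (fderiv ℝ τ y₀ w) +
      B (τ y₀) (fderiv ℝ (fderiv ℝ τ) y₀ v w) := by
    have h1 : (fun y ↦ B y w) =ᶠ[𝓝 y₀] fun y ↦ B (τ y) (fderiv ℝ τ y w) := by
      filter_upwards [h] with y hy using hy w
    have h2 : HasFDerivAt (fun y ↦ B y w) (B.flip w) y₀ := (B.flip w).hasFDerivAt
    have h3 := (B.hasFDerivAt.comp y₀ hd.hasFDerivAt).clm_apply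
      (hd2.hasFDerivAt.clm_apply (hasFDerivAt_const w y₀))
    have := DFunLike.congr_fun (h2.unique (h3.congr_of_eventuallyEq h1)) v
    simp at this
    rw [this, add_comm]
  have e1 := key v w
  have e2 := key w v
  have e3 := hsymm v w
  change B v w - B w v = B _ _ - B _ _
  rw [e1, e2, e3]
  ring

/-- `extDerivOne` uses a different chart at each point. Smoothness needs one fixed chart around
`ξ₀`, and the change of charts preserves `p dq`, so `skewForm_invariant` applies to it. -/
theorem symplecticForm_apply {ξ₀ ξ : Cotangent 𝓜 M}
    (h : ξ.proj ∈ (chartAt E ξ₀.proj).source) (v w : TangentSpace 𝓒 ξ) :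
    symplecticForm 𝓜 M ξ v w = canonicalForm E
      (mfderiv 𝓒 𝓘(ℝ, E × (E →L[ℝ] ℝ)) (extChartAt 𝓒 ξ₀) ξ v)
      (mfderiv 𝓒 𝓘(ℝ, E × (E →L[ℝ] ℝ)) (extChartAt 𝓒 ξ₀) ξ w) := by
  have hc : ξ ∈ (extChartAt 𝓒 ξ₀).source := mem_extChartAt_cotangent_source.2 h
  have hc' : ξ ∈ (chartAt (ModelProd E (E →L[ℝ] ℝ)) ξ₀).source := by
    rwa [← extChartAt_source (I := 𝓒)]
  have hc₀ : (extChartAt 𝓒 ξ).symm (extChartAt 𝓒 ξ ξ) ∈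
      (chartAt (ModelProd E (E →L[ℝ] ℝ)) ξ₀).source := by rwa [extChartAt_to_inv]
  rw [symplecticForm_self, ← fderiv_chart_transition_self hc']
  refine skewForm_invariant (F := E × (E →L[ℝ] ℝ)) ((contDiffAt_chart_transition (I := 𝓒)
    (mem_extChartAt_target ξ) hc₀).of_le (ENat.LEInfty.out)) ?_ v w
  have hsymm : ContinuousAt (extChartAt 𝓒 ξ).symm (extChartAt 𝓒 ξ ξ) :=
    continuousAt_extChartAt_symm ξ
  filter_upwards [extChartAt_target_mem_nhds (I := 𝓒) ξ, hsymm.preimage_mem_nhds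
    (extChartAt_source_mem_nhds' (I := 𝓒) (by rwa [extChartAt_to_inv]))] with y hy hy' w
  have hs := mem_extChartAt_cotangent_source.1 hy'
  have hs' := mem_extChartAt_cotangent_source.1 ((extChartAt 𝓒 ξ).map_target hy)
  have e0 := fderiv_chart_transition (I := 𝓒) hy (x₀ := ξ₀)
    (by rwa [← extChartAt_source (I := 𝓒)])
  set u : TangentSpace 𝓒 ((extChartAt 𝓒 ξ).symm y) :=
    mfderivWithin 𝓘(ℝ, E × (E →L[ℝ] ℝ)) 𝓒 (extChartAt 𝓒 ξ).symm (range 𝓒) y w with hu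
  have h1 := liouvilleForm_apply hs u
  have h2 := liouvilleForm_apply hs' u
  have h3 := DFunLike.congr_fun
    (mfderiv_extChartAt_comp_mfderivWithin_extChartAt_symm (I := 𝓒) hy) w
  rw [(extChartAt 𝓒 ξ).right_inv hy] at h2
  rw [e0]
  refine Eq.trans ?_ (h2.symm.trans h1)
  exact congrArg (fun z : E × (E →L[ℝ] ℝ) ↦ y.2 z.1) h3.symm

theorem isInvertible_of_separatingLeft {F : Type*} [NormedAddCommGroup F] [NormedSpace ℝ F]
    [FiniteDimensional ℝ F] {B : F →L[ℝ] F →L[ℝ] ℝ} (h : ∀ v, (∀ w, B v w = 0) → v = 0) :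
    B.IsInvertible := by
  have hinj : Function.Injective (B : F →ₗ[ℝ] F →L[ℝ] ℝ) :=
    (injective_iff_map_eq_zero _).2 fun v hv ↦ h v fun w ↦ DFunLike.congr_fun hv w
  have hfin : Module.finrank ℝ F = Module.finrank ℝ (F →L[ℝ] ℝ) := by
    rw [← (LinearMap.toContinuousLinearMap (𝕜 := ℝ) (E := F) (F' := ℝ)).finrank_eq]
    exact (Subspace.dual_finrank_eq (K := ℝ)).symm
  exact ⟨(LinearEquiv.ofInjectiveOfFinrankEq (B : F →ₗ[ℝ] F →L[ℝ] ℝ)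
    hinj hfin).toContinuousLinearEquiv, by ext1; rfl⟩

variable [FiniteDimensional ℝ E]

theorem isInvertible_canonicalForm : (canonicalForm E).IsInvertible := by
  refine isInvertible_of_separatingLeft fun v hv ↦ ?_
  have h (w : E × (E →L[ℝ] ℝ)) : v.2 w.1 - w.2 v.1 = 0 := hv w
  refine Prod.ext ?_ (ContinuousLinearMap.ext fun e ↦ by simpa using h (e, 0))
  exact SeparatingDual.eq_zero_of_forall_dual_eq_zero (R := ℝ) fun f ↦ by simpa using h (0, f)

theorem isInvertible_symplecticForm (ξ : Cotangent 𝓜 M) :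
    (symplecticForm 𝓜 M ξ).IsInvertible := by
  rw [symplecticForm_self]
  exact isInvertible_canonicalForm

theorem symplecticForm_symplecticDual (ξ : Cotangent 𝓜 M) (β : TangentSpace 𝓒 ξ →L[ℝ] ℝ) :
    symplecticForm 𝓜 M ξ (symplecticDual 𝓜 ξ β) = β :=
  (isInvertible_symplecticForm ξ).self_apply_inverse β

/-- In the chart at `ξ₀` the form is constant, so the coordinates of `V` are the image of `b` under
one fixed linear isomorphism. -/
theorem isSmoothField_of_symplecticForm_eq {V : Π ξ : Cotangent 𝓜 M, TangentSpace 𝓒 ξ}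
    (h : ∀ ξ₀ : Cotangent 𝓜 M, ∃ b : Cotangent 𝓜 M → ((E × (E →L[ℝ] ℝ)) →L[ℝ] ℝ),
      ContMDiffAt 𝓒 𝓘(ℝ, (E × (E →L[ℝ] ℝ)) →L[ℝ] ℝ) ∞ b ξ₀ ∧
      ∀ ξ, ξ.proj ∈ (chartAt E ξ₀.proj).source → symplecticForm 𝓜 M ξ (V ξ) =
        (b ξ).comp (mfderiv 𝓒 𝓘(ℝ, E × (E →L[ℝ] ℝ)) (extChartAt 𝓒 ξ₀) ξ)) :
    IsSmoothField 𝓒 V := by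
  refine isSmoothField_of_chart fun ξ₀ ↦ ?_
  obtain ⟨b, hb, hV⟩ := h ξ₀
  obtain ⟨e, he⟩ := isInvertible_canonicalForm (E := E)
  refine ⟨_, (e.symm : _ →L[ℝ] _).contMDiff.contMDiffAt.comp ξ₀ hb, fun ξ hc ↦ ?_⟩
  have hξ : ξ ∈ (extChartAt 𝓒 ξ₀).source := by rwa [extChartAt_source]
  have hs := mem_extChartAt_cotangent_source.1 hξ
  refine (e.symm_apply_eq.2 ?_).symm
  obtain ⟨d, hd⟩ := isInvertible_mfderiv_extChartAt (I := 𝓒) hξ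
  refine ContinuousLinearMap.ext fun w ↦ ?_
  have h3 := symplecticForm_apply hs (V ξ) (d.symm w)
  rw [hV ξ hs, ← hd, ← he] at h3
  rw [← hd]
  exact (((congrArg (b ξ) (d.apply_symm_apply w)).symm.trans h3).trans
    (congrArg (e (d (V ξ))) (d.apply_symm_apply w)))

end CotangentCharts

/-! ### The derivative of a lifted translation in coordinates. -/

section Flat
variable {E : Type*} [NormedAddCommGroup E] [NormedSpace ℝ E] {m : E × E → E} {u₀ q₀ : E}

theorem fderiv_comp_inr_of_unit (hm : DifferentiableAt ℝ m (u₀, q₀))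
    (h : ∀ᶠ q in 𝓝 q₀, m (u₀, q) = q) :
    (fderiv ℝ m (u₀, q₀)).comp (ContinuousLinearMap.inr ℝ E E) = ContinuousLinearMap.id ℝ E := by
  have h1 : HasFDerivAt (fun q ↦ m (u₀, q)) _ q₀ :=
    hm.hasFDerivAt.comp q₀ (hasFDerivAt_prodMk_right u₀ q₀)
  exact h1.unique ((hasFDerivAt_id q₀).congr_of_eventuallyEq h)

theorem hasDerivAt_ringInverse_of_eq_one {R : Type*} [NormedRing R] [NormedAlgebra ℝ R]
    [HasSummableGeomSeries R] {A : ℝ → R} {A' : R} (h : HasDerivAt A A' 0) (h0 : A 0 = 1) :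
    HasDerivAt (fun t ↦ Ring.inverse (A t)) (-A') 0 := by
  have h3 := hasFDerivAt_ringInverse (𝕜 := ℝ) (1 : Rˣ)
  rw [Units.val_one, ← h0] at h3
  refine (h3.comp_hasDerivAt (0 : ℝ) h).congr_deriv ?_
  rw [neg_apply, ContinuousLinearMap.mulLeftRight_apply, inv_one,
    Units.val_one, one_mul, mul_one]

theorem hasDerivAt_inverse_of_eq_id [CompleteSpace E] {A : ℝ → E →L[ℝ] E} {A' : E →L[ℝ] E}
    (h : HasDerivAt A A' 0) (h0 : A 0 = ContinuousLinearMap.id ℝ E) :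
    HasDerivAt (fun t ↦ (A t).inverse) (-A') 0 := by
  have := hasDerivAt_ringInverse_of_eq_one h h0
  rwa [ContinuousLinearMap.ringInverse_eq_inverse] at this

/-- The curve is the cotangent lift of `q ↦ m (u t, q)` in coordinates. As `D₂m` is the identity at
`u₀`, where inversion has derivative `-1`, the fibre component has derivative `-p ∘ D₂D₁m(X, ·)`. -/
theorem hasDerivAt_partial_inverse [CompleteSpace E] (hm : ContDiffAt ℝ 2 m (u₀, q₀))
    (h : ∀ᶠ q in 𝓝 q₀, m (u₀, q) = q) {u : ℝ → E} {X : E} (hu : HasDerivAt u X 0)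
    (hu0 : u 0 = u₀) (p : E →L[ℝ] ℝ) :
    HasDerivAt (fun t ↦ (m (u t, q₀), p.comp
      ((fderiv ℝ m (u t, q₀)).comp (ContinuousLinearMap.inr ℝ E E)).inverse))
      (fderiv ℝ m (u₀, q₀) (X, 0), -(p.comp
        ((fderiv ℝ (fderiv ℝ m) (u₀, q₀) (X, 0)).comp (ContinuousLinearMap.inr ℝ E E)))) 0 := by
  subst hu0
  have hd := hm.differentiableAt two_ne_zero
  have hd2 : DifferentiableAt ℝ (fderiv ℝ m) (u 0, q₀) :=
    (hm.fderiv_right (m := 1) (by norm_num)).differentiableAt one_ne_zero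
  have hc : HasDerivAt (fun t ↦ (u t, q₀)) (X, 0) 0 := hu.prodMk (hasDerivAt_const 0 q₀)
  have h1 : HasDerivAt (fun t ↦ m (u t, q₀)) _ 0 := hd.hasFDerivAt.comp_hasDerivAt (0 : ℝ) hc
  have h2 : HasDerivAt (fun t ↦ fderiv ℝ m (u t, q₀)) _ 0 :=
    hd2.hasFDerivAt.comp_hasDerivAt (0 : ℝ) hc
  have h3 := (ContinuousLinearMap.precomp E
    (ContinuousLinearMap.inr ℝ E E)).hasFDerivAt.comp_hasDerivAt (0 : ℝ) h2
  have h4 := hasDerivAt_inverse_of_eq_id h3 (fderiv_comp_inr_of_unit hd h)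
  let P : (E →L[ℝ] E) →L[ℝ] (E →L[ℝ] ℝ) := ContinuousLinearMap.postcomp E p
  have h5 := HasFDerivAt.comp_hasDerivAt (0 : ℝ) P.hasFDerivAt h4
  refine (h1.prodMk h5).congr_deriv (Prod.ext rfl ?_)
  exact ContinuousLinearMap.comp_neg _ _

end Flat

/-! ### Invariant fields, moment functions and flow lifts of a smooth multiplication. -/

section Translations

variable {E : Type*} [NormedAddCommGroup E] [NormedSpace ℝ E]

local notation "𝓜" => modelWithCornersSelf ℝ E
local notation "𝓒" => cotModel (modelWithCornersSelf ℝ E)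

variable {G : Type*} [TopologicalSpace G] [ChartedSpace E G] [Group G]

/-- `a h x` is a smooth multiplication on `G` having the same unit and inverses as `G`: either
`a h x = h * x` or the opposite multiplication `a h x = x * h`. -/
structure IsSmoothTranslation (E : Type*) [NormedAddCommGroup E] [NormedSpace ℝ E]
    {G : Type*} [TopologicalSpace G] [ChartedSpace E G] [Group G] (a : G → G → G) : Prop where
  contMDiff : ContMDiff (𝓘(ℝ, E).prod 𝓘(ℝ, E)) 𝓘(ℝ, E) ∞ (fun z : G × G ↦ a z.1 z.2)
  one_left : ∀ x, a 1 x = x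
  one_right : ∀ h, a h 1 = h
  assoc : ∀ h k x, a h (a k x) = a (a h k) x
  self_inv : ∀ g, a g g⁻¹ = 1
  inv_self : ∀ g, a g⁻¹ g = 1

/-- The differential `T_e(h ↦ a h x)`. -/
def translationMap (a : G → G → G) (x : G) : GroupLieAlgebra 𝓜 G →L[ℝ] TangentSpace 𝓜 x :=
  mfderiv 𝓜 𝓜 (fun h : G ↦ a h x) (1 : G)

/-- The vector field `x ↦ T_e(h ↦ a h x) X`. -/
def translationField (a : G → G → G) (X : GroupLieAlgebra 𝓜 G) (x : G) : TangentSpace 𝓜 x :=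
  translationMap a x X

/-- The `𝔤`-valued form `T_g(h ↦ a h g⁻¹)`. -/
def translationForm (a : G → G → G) (g : G) : TangentSpace 𝓜 g →L[ℝ] GroupLieAlgebra 𝓜 G :=
  mfderiv 𝓜 𝓜 (fun h : G ↦ a h g⁻¹) g

/-- The map `a` read in the charts at `1` and `x₀`. -/
def localTranslation (E : Type*) [NormedAddCommGroup E] [NormedSpace ℝ E]
    {G : Type*} [TopologicalSpace G] [ChartedSpace E G] [Group G] (a : G → G → G) (x₀ : G)
    (z : E × E) : E :=
  extChartAt 𝓘(ℝ, E) x₀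
    (a ((extChartAt 𝓘(ℝ, E) (1 : G)).symm z.1) ((extChartAt 𝓘(ℝ, E) x₀).symm z.2))

/-- The point `1` read in the chart at `1`. -/
def unitPoint (E : Type*) [NormedAddCommGroup E] [NormedSpace ℝ E]
    (G : Type*) [TopologicalSpace G] [ChartedSpace E G] [Group G] : E :=
  extChartAt 𝓘(ℝ, E) (1 : G) (1 : G)

omit [Group G] in
-- Tangent spaces at equal points are different types, but both unfold to `E`; stating the equality
-- over `E` avoids transport along `a 1 x = x`.
theorem congr_mfderiv_point {F : Type*} [NormedAddCommGroup F] [NormedSpace ℝ F]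
    {N : Type*} [TopologicalSpace N] [ChartedSpace F N] (f : G → N) {x y : G} (h : x = y) :
    (mfderiv 𝓜 𝓘(ℝ, F) f x : E →L[ℝ] F) = mfderiv 𝓜 𝓘(ℝ, F) f y := by
  subst h
  rfl

variable {a : G → G → G}

theorem localTranslation_unit (ha : IsSmoothTranslation E a) {x₀ : G} {q : E}
    (hq : q ∈ (extChartAt 𝓜 x₀).target) : localTranslation E a x₀ (unitPoint E G, q) = q := by
  simp only [localTranslation, unitPoint, extChartAt_to_inv, ha.one_left]
  exact (extChartAt 𝓜 x₀).right_inv hq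

theorem IsSmoothTranslation.mdifferentiable_left (ha : IsSmoothTranslation E a) (x : G) :
    MDifferentiable 𝓜 𝓜 (fun h ↦ a h x) :=
  (ha.contMDiff.comp (contMDiff_id.prodMk contMDiff_const)).mdifferentiable (by simp)

theorem IsSmoothTranslation.mdifferentiable_right (ha : IsSmoothTranslation E a) (h : G) :
    MDifferentiable 𝓜 𝓜 (a h) :=
  (ha.contMDiff.comp (contMDiff_const.prodMk contMDiff_id)).mdifferentiable (by simp)

/-- Equivariance comes from differentiating `a k (a h x) = a (a k h) x` in `k` at `1`. -/
theorem mfderiv_translationField (ha : IsSmoothTranslation E a) (X : E)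
    (h x : G) : mfderiv 𝓜 𝓜 (fun k ↦ a k x) h (translationField (E := E) a X h) =
      translationField (E := E) a X (a h x) := by
  have h1 : (fun k ↦ a k (a h x)) = (fun k ↦ a k x) ∘ fun k ↦ a k h := by
    ext k
    exact ha.assoc k h x
  have h2 := mfderiv_comp_of_eq (ha.mdifferentiable_left x h) (ha.mdifferentiable_left h 1)
    (ha.one_left h)
  rw [← h1] at h2
  have h3 : (mfderiv 𝓜 𝓜 (fun k ↦ a k x) (a 1 h) : E →L[ℝ] E) =
      mfderiv 𝓜 𝓜 (fun k ↦ a k x) h := congr_mfderiv_point _ (ha.one_left h)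
  exact ((DFunLike.congr_fun h2 X).trans (DFunLike.congr_fun h3 _)).symm

theorem translationForm_comp_translationMap (ha : IsSmoothTranslation E a) (g : G) :
    (translationForm a g).comp (translationMap a g) =
      ContinuousLinearMap.id ℝ (GroupLieAlgebra 𝓜 G) := by
  have h1 : ((fun k ↦ a k g⁻¹) ∘ fun k ↦ a k g) = id := by
    ext k
    simp [← ha.assoc, ha.self_inv, ha.one_right]
  have h2 := mfderiv_comp_of_eq (ha.mdifferentiable_left g⁻¹ g) (ha.mdifferentiable_left g 1)
    (ha.one_left g)
  rw [h1, mfderiv_id] at h2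
  have h3 : (mfderiv 𝓜 𝓜 (fun k ↦ a k g⁻¹) (a 1 g) : E →L[ℝ] E) =
      mfderiv 𝓜 𝓜 (fun k ↦ a k g⁻¹) g := congr_mfderiv_point _ (ha.one_left g)
  ext X
  exact ((DFunLike.congr_fun h2 X).trans (DFunLike.congr_fun h3 _)).symm

theorem translationMap_comp_translationForm (ha : IsSmoothTranslation E a) (g : G) :
    (translationMap a g).comp (translationForm a g) =
      ContinuousLinearMap.id ℝ (TangentSpace 𝓜 g) := by
  have h1 : ((fun k ↦ a k g) ∘ fun k ↦ a k g⁻¹) = id := by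
    ext k
    simp [← ha.assoc, ha.one_right, ha.inv_self]
  have h2 := mfderiv_comp_of_eq (ha.mdifferentiable_left g 1) (ha.mdifferentiable_left g⁻¹ g)
    (ha.self_inv g)
  rw [h1, mfderiv_id] at h2
  have h3 : (mfderiv 𝓜 𝓜 (fun k ↦ a k g) (a g g⁻¹) : E →L[ℝ] E) =
      mfderiv 𝓜 𝓜 (fun k ↦ a k g) 1 := congr_mfderiv_point _ (ha.self_inv g)
  ext X
  exact ((DFunLike.congr_fun h2 X).trans (DFunLike.congr_fun h3 _)).symm

theorem inverse_translationForm (ha : IsSmoothTranslation E a) (g : G) :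
    (translationForm (E := E) a g).inverse = translationMap a g :=
  ContinuousLinearMap.inverse_eq (translationForm_comp_translationMap ha g)
    (translationMap_comp_translationForm ha g)

theorem isMIntegralCurveOn_translate (ha : IsSmoothTranslation E a) {X : E}
    {γ : ℝ → G} {s : Set ℝ}
    (hγ : IsMIntegralCurveOn (I := 𝓜) γ (translationField (E := E) a X) s) (x : G) :
    IsMIntegralCurveOn (I := 𝓜) (fun t ↦ a (γ t) x) (translationField (E := E) a X) s := by
  intro t ht
  have h1 := (ha.mdifferentiable_left x (γ t)).hasMFDerivAt.comp_hasMFDerivWithinAt t (hγ t ht)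
  refine h1.congr_mfderiv (ContinuousLinearMap.ext_ring ?_)
  refine (congrArg (mfderiv 𝓜 𝓜 (fun k ↦ a k x) (γ t))
    (one_smul ℝ (translationField (E := E) a X (γ t)))).trans ?_
  refine (mfderiv_translationField ha X (γ t) x).trans ?_
  exact (one_smul ℝ (translationField (E := E) a X (a (γ t) x))).symm

theorem translationField_one (ha : IsSmoothTranslation E a) (X : E) :
    translationField (E := E) a X (1 : G) = X := by
  have h1 : ∀ f : G → G, f = id →
      (mfderiv 𝓜 𝓜 f (1 : G) (show GroupLieAlgebra 𝓜 G from X) : E) = X := by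
    rintro f rfl
    rw [mfderiv_id]
    rfl
  exact h1 _ (funext ha.one_right)

variable [IsManifold 𝓘(ℝ, E) ∞ G]

theorem contDiffAt_localTranslation (ha : IsSmoothTranslation E a) {x₀ : G} {q : E}
    (hq : q ∈ (extChartAt 𝓜 x₀).target) :
    ContDiffAt ℝ ∞ (localTranslation E a x₀) (unitPoint E G, q) := by
  have h1 : ContMDiffAt 𝓘(ℝ, E × E) 𝓜 ∞ (fun z : E × E ↦ (extChartAt 𝓜 (1 : G)).symm z.1)
      (unitPoint E G, q) :=
    (contMDiffAt_extChartAt_symm_of_boundaryless (mem_extChartAt_target (1 : G))).comp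
      (unitPoint E G, q) contDiffAt_fst.contMDiffAt
  have h2 : ContMDiffAt 𝓘(ℝ, E × E) 𝓜 ∞ (fun z : E × E ↦ (extChartAt 𝓜 x₀).symm z.2)
      (unitPoint E G, q) :=
    (contMDiffAt_extChartAt_symm_of_boundaryless hq).comp
      (unitPoint E G, q) contDiffAt_snd.contMDiffAt
  have h3 := (ha.contMDiff.contMDiffAt).comp (unitPoint E G, q) (h1.prodMk h2)
  refine (ContMDiffAt.comp (unitPoint E G, q) (contMDiffAt_extChartAt' ?_) h3).contDiffAt
  simp only [Function.comp_apply, unitPoint, extChartAt_to_inv, ha.one_left]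
  rw [← extChartAt_source 𝓜]
  exact (extChartAt 𝓜 x₀).map_target hq

/-- In coordinates the field is `D₁m` at the unit, with `m` the local multiplication. All smoothness
of fields, forms and moment functions is deduced from this formula. -/
theorem mfderiv_chart_translationField (ha : IsSmoothTranslation E a) {x₀ x : G}
    (hx : x ∈ (chartAt E x₀).source) (X : E) :
    mfderiv 𝓜 𝓜 (extChartAt 𝓜 x₀) x (translationField (E := E) a X x) =
      fderiv ℝ (localTranslation E a x₀) (unitPoint E G, extChartAt 𝓜 x₀ x)
        (X, 0) := by
  have hs : x ∈ (extChartAt 𝓜 x₀).source := by rwa [extChartAt_source]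
  have hd := mdifferentiableAt_extChartAt (I := 𝓜) hx
  have h1 : mfderiv 𝓜 𝓜 (extChartAt 𝓜 x₀ ∘ fun h ↦ a h x) 1 = _ :=
    mfderiv_comp_of_eq hd (ha.mdifferentiable_left x 1) (ha.one_left x)
  have h2 : (mfderiv 𝓜 𝓜 (extChartAt 𝓜 x₀) (a 1 x) : E →L[ℝ] E) =
      mfderiv 𝓜 𝓜 (extChartAt 𝓜 x₀) x :=
    congr_mfderiv_point _ (ha.one_left x)
  have h3 : MDifferentiableAt 𝓜 𝓜 (extChartAt 𝓜 x₀ ∘ fun h ↦ a h x) 1 :=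
    MDifferentiableAt.comp_of_eq (1 : G) hd (ha.mdifferentiable_left x 1) (ha.one_left x)
  have h4 := mfderiv_eq_fderiv_comp_symm h3
  have h5 : HasFDerivAt (fun u ↦ localTranslation E a x₀ (u, extChartAt 𝓜 x₀ x)) _
      (unitPoint E G) :=
    HasFDerivAt.comp (g := localTranslation E a x₀) (unitPoint E G)
      ((contDiffAt_localTranslation ha ((extChartAt 𝓜 x₀).map_source hs)).differentiableAt
      (by simp)).hasFDerivAt (hasFDerivAt_prodMk_left _ _)
  have h6 : (fun u ↦ localTranslation E a x₀ (u, extChartAt 𝓜 x₀ x)) =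
      (extChartAt 𝓜 x₀ ∘ fun h ↦ a h x) ∘ (extChartAt 𝓜 (1 : G)).symm := by
    ext u
    simp only [localTranslation, Function.comp_apply, (extChartAt 𝓜 x₀).left_inv hs]
  rw [h6] at h5
  have h7 := h4.trans h5.fderiv
  have e1 := DFunLike.congr_fun h1 X
  have e2 := DFunLike.congr_fun h2 (translationField (E := E) a X x)
  have e7 := DFunLike.congr_fun h7 X
  exact (e1.trans e2).symm.trans e7

theorem contDiffAt_fderiv_localTranslation (ha : IsSmoothTranslation E a) {x₀ : G} {q : E}
    (hq : q ∈ (extChartAt 𝓜 x₀).target) :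
    ContDiffAt ℝ ∞ (fun q ↦ fderiv ℝ (localTranslation E a x₀) (unitPoint E G, q)) q :=
  ((contDiffAt_localTranslation ha hq).fderiv_right (m := ∞) (by simp)).comp q
    (contDiffAt_const.prodMk contDiffAt_id)

theorem contMDiffAt_fderiv_localTranslation (ha : IsSmoothTranslation E a) {x₀ : G} :
    ContMDiffAt 𝓜 𝓘(ℝ, E × E →L[ℝ] E) ∞ (fun x ↦ fderiv ℝ (localTranslation E a x₀)
      (unitPoint E G, extChartAt 𝓜 x₀ x)) x₀ :=
  (contDiffAt_fderiv_localTranslation ha (mem_extChartAt_target x₀)).contMDiffAt.comp x₀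
    contMDiffAt_extChartAt

theorem isSmoothField_translationField (ha : IsSmoothTranslation E a)
    (X : E) : IsSmoothField 𝓜 (translationField (E := E) a X) :=
  isSmoothField_of_chart fun x₀ ↦ ⟨fun x ↦ fderiv ℝ (localTranslation E a x₀)
      (unitPoint E G, extChartAt 𝓜 x₀ x) (X, 0),
    (contMDiffAt_fderiv_localTranslation ha).clm_apply (contMDiffAt_const (c := (X, (0 : E)))),
    fun _ hx ↦ mfderiv_chart_translationField ha hx X⟩

/-- The function `ξ ↦ ⟨ξ, T_e(h ↦ a h g) X⟩` for `ξ ∈ T_g^*G`. -/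
def momentFunction (a : G → G → G) (X : E) (ξ : Cotangent 𝓜 G) : ℝ :=
  ξ.snd (translationField (E := E) a X ξ.proj)

theorem momentFunction_chart (ha : IsSmoothTranslation E a) (X : E)
    {ξ₀ ξ : Cotangent 𝓜 G} (h : ξ.proj ∈ (chartAt E ξ₀.proj).source) :
    momentFunction (E := E) a X ξ = (extChartAt 𝓒 ξ₀ ξ).2 (fderiv ℝ (localTranslation E a ξ₀.proj)
      (unitPoint E G, (extChartAt 𝓒 ξ₀ ξ).1) (X, 0)) := by
  have h1 := DFunLike.congr_fun (snd_eq_chart_comp h) (translationField (E := E) a X ξ.proj)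
  have h2 : (extChartAt 𝓒 ξ₀ ξ).1 = extChartAt 𝓜 ξ₀.proj ξ.proj :=
    congrArg Prod.fst (extChartAt_cotangent_apply h)
  rw [h2, ← mfderiv_chart_translationField ha h]
  exact h1

theorem contMDiff_momentFunction (ha : IsSmoothTranslation E a) (X : E) :
    ContMDiff 𝓒 𝓘(ℝ, ℝ) ∞ (momentFunction (E := E) a X) := by
  intro ξ₀
  have h1 : ContMDiffAt 𝓒 𝓘(ℝ, E × (E →L[ℝ] ℝ)) ∞ (extChartAt 𝓒 ξ₀) ξ₀ := contMDiffAt_extChartAt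
  have h2 : ContMDiffAt 𝓒 𝓜 ∞ (fun ξ ↦ (extChartAt 𝓒 ξ₀ ξ).1) ξ₀ :=
    contDiffAt_fst.contMDiffAt.comp ξ₀ h1
  have h3 : ContMDiffAt 𝓒 𝓘(ℝ, E →L[ℝ] ℝ) ∞ (fun ξ ↦ (extChartAt 𝓒 ξ₀ ξ).2) ξ₀ :=
    contDiffAt_snd.contMDiffAt.comp ξ₀ h1
  have h4 : (extChartAt 𝓒 ξ₀ ξ₀).1 ∈ (extChartAt 𝓜 ξ₀.proj).target := by
    rw [extChartAt_cotangent_apply (mem_chart_source E ξ₀.proj)]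
    exact mem_extChartAt_target ξ₀.proj
  have h5 := (contDiffAt_fderiv_localTranslation ha h4).contMDiffAt.comp ξ₀ h2
  refine (h3.clm_apply (h5.clm_apply (contMDiffAt_const (c := (X, (0 : E)))))
    ).congr_of_eventuallyEq ?_
  filter_upwards [extChartAt_source_mem_nhds (I := 𝓒) ξ₀] with ξ hξ
  exact momentFunction_chart ha X (mem_extChartAt_cotangent_source.1 hξ)

/-- The second derivative `D₂ D₁ m (X, ·)` at the unit of `a` read in the charts at `1` and `x`,
i.e. the derivative of the translation field of `X` read in the chart at `x`. -/
def fieldDeriv (a : G → G → G) (x : G) (X : E) : E →L[ℝ] E :=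
  (fderiv ℝ (fderiv ℝ (localTranslation E a x)) (unitPoint E G, extChartAt 𝓜 x x) (X, 0)).comp
    (ContinuousLinearMap.inr ℝ E E)

/-- `fieldDeriv` has `X` in its first slot, as the flow lift produces it; symmetry of the second
derivative identifies it with the derivative of the field in `q`. -/
theorem hasFDerivAt_fieldDeriv (ha : IsSmoothTranslation E a) (x : G) (X : E) :
    HasFDerivAt (fun q ↦ fderiv ℝ (localTranslation E a x) (unitPoint E G, q) (X, 0))
      (fieldDeriv a x X) (extChartAt 𝓜 x x) := by
  have h1 := contDiffAt_localTranslation ha (mem_extChartAt_target (I := 𝓜) x)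
  have h2 := ((h1.fderiv_right (m := ∞) (by simp)).differentiableAt (by simp)).hasFDerivAt
  have h3 : HasFDerivAt (fun q ↦ fderiv ℝ (localTranslation E a x) (unitPoint E G, q)) _
    (extChartAt 𝓜 x x) := h2.comp _ (hasFDerivAt_prodMk_right _ _)
  refine (h3.clm_apply (hasFDerivAt_const ((X, 0) : E × E) _)).congr_fderiv ?_
  have hsymm := h1.isSymmSndFDerivAt (by simpa using ENat.LEInfty.out)
  ext q
  simpa [fieldDeriv] using hsymm (0, q) (X, 0)

omit [Group G] in
theorem extChartAt_cotangent_self (ξ : Cotangent 𝓜 G) :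
    extChartAt 𝓒 ξ ξ = (extChartAt 𝓜 ξ.proj ξ.proj, ξ.snd) := by
  rw [extChartAt_cotangent_apply (mem_chart_source E ξ.proj), mfderivWithin_range_extChartAt_symm]
  rfl

theorem translationField_eq (ha : IsSmoothTranslation E a) (X : E) (x : G) :
    translationField (E := E) a X x = fderiv ℝ (localTranslation E a x)
      (unitPoint E G, extChartAt 𝓜 x x) (X, 0) := by
  rw [← mfderiv_chart_translationField ha (mem_chart_source E x), mfderiv_extChartAt_self]
  rfl

theorem differential_momentFunction (ha : IsSmoothTranslation E a) (X : E)
    (ξ : Cotangent 𝓜 G) (v : TangentSpace 𝓒 ξ) :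
    differential 𝓒 (momentFunction (E := E) a X) ξ v =
      (show E × (E →L[ℝ] ℝ) from v).2 (translationField (E := E) a X ξ.proj) +
      ξ.snd (fieldDeriv a ξ.proj X (show E × (E →L[ℝ] ℝ) from v).1) := by
  have h1 := mfderiv_eq_fderiv_comp_symm
    (((contMDiff_momentFunction ha X).mdifferentiable (by simp)) ξ)
  have h2 : (momentFunction (E := E) a X ∘ (extChartAt 𝓒 ξ).symm) =ᶠ[𝓝 (extChartAt 𝓒 ξ ξ)]
      fun y : E × (E →L[ℝ] ℝ) ↦ y.2 (fderiv ℝ (localTranslation E a ξ.proj)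
        (unitPoint E G, y.1) (X, 0)) := by
    filter_upwards [extChartAt_target_mem_nhds (I := 𝓒) ξ] with y hy
    have := momentFunction_chart ha X
      (mem_extChartAt_cotangent_source.1 ((extChartAt 𝓒 ξ).map_target hy))
    rwa [(extChartAt 𝓒 ξ).right_inv hy] at this
  set p : E →L[ℝ] ℝ := ξ.snd with hp
  set q₀ : E := extChartAt 𝓜 ξ.proj ξ.proj with hq₀
  have h3 := HasFDerivAt.comp (g := fun q ↦ fderiv ℝ (localTranslation E a ξ.proj)
      (unitPoint E G, q) (X, 0)) (f := Prod.fst) (q₀, p)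
      (hasFDerivAt_fieldDeriv ha ξ.proj X) hasFDerivAt_fst
  have h4 := HasFDerivAt.clm_apply (hasFDerivAt_snd (𝕜 := ℝ) (p := (q₀, p))) h3
  rw [extChartAt_cotangent_self] at h2
  have h5 := h1.trans (by rw [extChartAt_cotangent_self]; exact (h4.congr_of_eventuallyEq h2).fderiv)
  refine (DFunLike.congr_fun h5 v).trans ?_
  rw [translationField_eq ha]
  exact add_comm _ _

theorem mfderiv_chart_comp_mfderiv_translate (ha : IsSmoothTranslation E a) {h x : G}
    (hh : h ∈ (chartAt E (1 : G)).source) (hx : a h x ∈ (chartAt E x).source)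
    (hd : DifferentiableAt ℝ (localTranslation E a x)
      (extChartAt 𝓜 1 h, extChartAt 𝓜 x x)) :
    (mfderiv 𝓜 𝓜 (extChartAt 𝓜 x) (a h x)).comp (mfderiv 𝓜 𝓜 (a h) x) =
      (fderiv ℝ (localTranslation E a x) (extChartAt 𝓜 1 h, extChartAt 𝓜 x x)).comp
        (ContinuousLinearMap.inr ℝ E E) := by
  have h1 := mdifferentiableAt_extChartAt (I := 𝓜) hx
  have h2 := mfderiv_eq_fderiv_comp_symm (h1.comp x (ha.mdifferentiable_right h x))
  rw [mfderiv_comp x h1 (ha.mdifferentiable_right h x)] at h2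
  refine h2.trans (HasFDerivAt.fderiv ?_)
  refine (hd.hasFDerivAt.comp _ (hasFDerivAt_prodMk_right _ _)).congr_of_eventuallyEq
    (Filter.Eventually.of_forall fun q ↦ ?_)
  have hh' : h ∈ (extChartAt 𝓜 (1 : G)).source := by rwa [extChartAt_source]
  simp only [localTranslation, Function.comp_apply, (extChartAt 𝓜 (1 : G)).left_inv hh']

omit [Group G] in
theorem mfderivWithin_chart_symm_eq_inverse {x₀ y : G} (hy : y ∈ (chartAt E x₀).source) :
    (mfderivWithin 𝓜 𝓜 (extChartAt 𝓜 x₀).symm (range 𝓜) (extChartAt 𝓜 x₀ y) : E →L[ℝ] E) =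
      (mfderiv 𝓜 𝓜 (extChartAt 𝓜 x₀) y).inverse := by
  have hs : y ∈ (extChartAt 𝓜 x₀).source := by rwa [extChartAt_source]
  exact (ContinuousLinearMap.inverse_eq (f := (mfderiv 𝓜 𝓜 (extChartAt 𝓜 x₀) y : E →L[ℝ] E))
    (mfderiv_extChartAt_comp_mfderivWithin_extChartAt_symm' hs)
    (mfderivWithin_extChartAt_symm_comp_mfderiv_extChartAt' hs)).symm

omit [Group G] [IsManifold 𝓜 ∞ G] in
theorem cotangentMap_id (ξ : Cotangent 𝓜 G) : cotangentMap 𝓜 id ξ = ξ := by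
  rw [cotangentMap, mfderiv_id, ContinuousLinearMap.inverse_id]
  rfl

/-! ### Flows of the translation fields and their cotangent lifts. -/

variable [T2Space G] [CompleteSpace E]

/-- Translating one integral curve through `1` gives integral curves through every `x` on the same
time interval. This uniformity lets the flow at a fixed small `t` be differentiated in `x`. -/
theorem exists_flow_eq (ha : IsSmoothTranslation E a) (X : E) :
    ∃ γ : ℝ → G, γ 0 = 1 ∧
      HasMFDerivAt 𝓘(ℝ, ℝ) 𝓜 γ 0 ((1 : ℝ →L[ℝ] ℝ).smulRight (translationField (E := E) a X (γ 0))) ∧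
      ∀ᶠ t in 𝓝 0, ∀ x, flow 𝓜 (translationField (E := E) a X) t x = a (γ t) x := by
  have hV : ContMDiff 𝓜 (𝓜).tangent 1
      (fun x ↦ (⟨x, translationField (E := E) a X x⟩ : TangentBundle 𝓜 G)) :=
    (isSmoothField_translationField ha X).of_le (by simp)
  obtain ⟨γ, hγ0, hγ⟩ := exists_isMIntegralCurveAt_of_contMDiffAt_boundaryless 0 (hV 1)
  refine ⟨γ, hγ0, hγ.hasMFDerivAt, ?_⟩
  obtain ⟨ε, hε, hγε⟩ := isMIntegralCurveAt_iff'.1 hγ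
  filter_upwards [Metric.ball_mem_nhds (0 : ℝ) hε] with t ht x
  rw [Real.ball_eq_Ioo, zero_sub, zero_add] at hγε ht
  have hc := isMIntegralCurveOn_translate ha hγε x
  have hex : ∃ γ : ℝ → G, γ 0 = x ∧ ∃ b c : ℝ, 0 ∈ Ioo b c ∧ t ∈ Ioo b c ∧
      IsMIntegralCurveOn (I := 𝓜) γ (translationField (E := E) a X) (Ioo b c) :=
    ⟨_, by rw [hγ0, ha.one_left], -ε, ε, ⟨by linarith, hε⟩, ht, hc⟩
  rw [flow, dif_pos hex]
  obtain ⟨h0, b, c, h0bc, htbc, hint⟩ := hex.choose_spec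
  -- `flow` picks an arbitrary integral curve on an unknown interval; uniqueness is applied on the
  -- intersection of that interval with `(-ε, ε)`.
  refine isMIntegralCurveOn_Ioo_eqOn_of_contMDiff_boundaryless (t₀ := 0)
    (a := max b (-ε)) (b := min c ε) ?_ hV (hint.mono ?_) (hc.mono ?_) ?_ ?_
  · exact ⟨max_lt h0bc.1 (by linarith), lt_min h0bc.2 hε⟩
  · exact Ioo_subset_Ioo (le_max_left _ _) (min_le_left _ _)
  · exact Ioo_subset_Ioo (le_max_right _ _) (min_le_right _ _)
  · rw [h0, hγ0, ha.one_left]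
  · exact ⟨max_lt htbc.1 ht.1, lt_min htbc.2 ht.2⟩

theorem flowLift_translationField_aux (ha : IsSmoothTranslation E a) (X : E)
    (ξ : Cotangent 𝓜 G) :
    cotangentMap 𝓜 (flow 𝓜 (translationField (E := E) a X) 0) ξ = ξ ∧
    MDifferentiableAt 𝓘(ℝ, ℝ) 𝓒
      (fun t : ℝ ↦ cotangentMap 𝓜 (flow 𝓜 (translationField (E := E) a X) t) ξ) 0 ∧
    (flowLift 𝓜 (translationField (E := E) a X) ξ : E × (E →L[ℝ] ℝ)) =
      (translationField (E := E) a X ξ.proj,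
        -(ContinuousLinearMap.comp (show E →L[ℝ] ℝ from ξ.snd) (fieldDeriv a ξ.proj X))) := by
  obtain ⟨γ, hγ0, hγ, hflow⟩ := exists_flow_eq ha X
  set c : ℝ → Cotangent 𝓜 G :=
    fun t ↦ cotangentMap 𝓜 (flow 𝓜 (translationField (E := E) a X) t) ξ with hc
  set x := ξ.proj with hx
  set p : E →L[ℝ] ℝ := ξ.snd with hp
  have h0 : c 0 = ξ := by
    have : flow 𝓜 (translationField (E := E) a X) 0 = id := by
      ext x
      rw [hflow.self_of_nhds, hγ0, ha.one_left, id]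
    exact (congrArg (fun f : G → G ↦ cotangentMap 𝓜 f ξ) this).trans (cotangentMap_id ξ)
  have hcproj : ∀ᶠ t in 𝓝 0, c t = ⟨a (γ t) x, p.comp (mfderiv 𝓜 𝓜 (a (γ t)) x).inverse⟩ := by
    filter_upwards [hflow] with t ht
    have : flow 𝓜 (translationField (E := E) a X) t = a (γ t) := funext ht
    exact congrArg (fun f : G → G ↦ cotangentMap 𝓜 f ξ) this
  have hcont : ContinuousAt (fun t ↦ a (γ t) x) 0 :=
    (ha.mdifferentiable_left x (γ 0)).continuousAt.comp hγ.continuousAt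
  have hsrc : ∀ᶠ t in 𝓝 0, a (γ t) x ∈ (chartAt E x).source :=
    hcont.preimage_mem_nhds ((chartAt E x).open_source.mem_nhds (by
      rw [hγ0, ha.one_left]; exact mem_chart_source E x))
  have hsrcγ : ∀ᶠ t in 𝓝 0, γ t ∈ (chartAt E (1 : G)).source :=
    hγ.continuousAt.preimage_mem_nhds ((chartAt E (1 : G)).open_source.mem_nhds (by
      rw [hγ0]; exact mem_chart_source E (1 : G)))
  have hm := contDiffAt_localTranslation ha (mem_extChartAt_target (I := 𝓜) x)
  set u : ℝ → E := fun t ↦ extChartAt 𝓜 (1 : G) (γ t) with hu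
  have hu0 : u 0 = unitPoint E G := by simp only [hu, hγ0, unitPoint]
  have hu' : HasDerivAt u X 0 := by
    have h1 := (mdifferentiableAt_extChartAt (I := 𝓜)
      (show γ 0 ∈ (chartAt E (1 : G)).source from hsrcγ.self_of_nhds)).hasMFDerivAt.comp (0 : ℝ) hγ
    have h3 : HasFDerivAt u (_ : ℝ →L[ℝ] E) 0 := hasMFDerivAt_iff_hasFDerivAt.1 h1
    refine h3.hasDerivAt.congr_deriv ?_
    -- The base point is generalized so that `γ 0 = 1` can be substituted despite the dependent
    -- types.
    have h2 : ∀ g : G, g = 1 →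
        (mfderiv 𝓜 𝓜 (extChartAt 𝓜 (1 : G)) g (translationField (E := E) a X g) : E) = X := by
      rintro g rfl
      rw [mfderiv_extChartAt_self, translationField_one ha]
      rfl
    exact (congrArg (mfderiv 𝓜 𝓜 (extChartAt 𝓜 (1 : G)) (γ 0))
      (one_smul ℝ (translationField (E := E) a X (γ 0)))).trans (h2 (γ 0) hγ0)
  have hdiff : ∀ᶠ t in 𝓝 0, DifferentiableAt ℝ (localTranslation E a x)
      (u t, extChartAt 𝓜 x x) := by
    have h1 := (hm.of_le (m := 1) (by simp)).eventually (by simp)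
    have h2 : ContinuousAt (fun t ↦ (u t, extChartAt 𝓜 x x)) 0 :=
      hu'.continuousAt.prodMk continuousAt_const
    rw [ContinuousAt, hu0] at h2
    filter_upwards [h2.eventually h1] with t ht using ht.differentiableAt one_ne_zero
  -- In coordinates the inverse of the derivative of the translation is the inverse of `D₂m`, which
  -- puts the curve in the form of `hasDerivAt_partial_inverse`.
  have hchart : (fun t ↦ extChartAt 𝓒 ξ (c t)) =ᶠ[𝓝 0]
      fun t ↦ (localTranslation E a x (u t, extChartAt 𝓜 x x), p.comp
        ((fderiv ℝ (localTranslation E a x) (u t, extChartAt 𝓜 x x)).comp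
          (ContinuousLinearMap.inr ℝ E E)).inverse) := by
    filter_upwards [hcproj, hsrc, hsrcγ, hdiff] with t ht hs hsγ hd
    have hs' : (c t).proj ∈ (chartAt E ξ.proj).source := by rwa [ht]
    rw [extChartAt_cotangent_apply hs', ht]
    refine Prod.ext ?_ ?_
    · have hγs : γ t ∈ (extChartAt 𝓜 (1 : G)).source := by rwa [extChartAt_source]
      simp only [localTranslation, hu, extChartAt_to_inv, (extChartAt 𝓜 (1 : G)).left_inv hγs]
      rfl
    · have h1 := mfderiv_chart_comp_mfderiv_translate ha hsγ hs hd
      have h2 : (mfderiv 𝓜 𝓜 (extChartAt 𝓜 x) (a (γ t) x)).IsInvertible :=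
        isInvertible_mfderiv_extChartAt (by rwa [extChartAt_source])
      have h3 := h2.inverse_comp_of_left (f := mfderiv 𝓜 𝓜 (a (γ t)) x)
      have h4 := mfderivWithin_chart_symm_eq_inverse hs
      refine ContinuousLinearMap.ext fun w ↦ congrArg p ?_
      refine (congrArg (mfderiv 𝓜 𝓜 (a (γ t)) x).inverse (DFunLike.congr_fun h4 w)).trans ?_
      refine (DFunLike.congr_fun h3.symm w).trans ?_
      exact congrArg (fun L : E →L[ℝ] E ↦ L.inverse w) h1
  have hfin := (hasDerivAt_partial_inverse (hm.of_le ENat.LEInfty.out) ?_ hu' hu0 p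
    ).congr_of_eventuallyEq hchart
  · have hcs : ∀ᶠ t in 𝓝 0, c t ∈ (extChartAt 𝓒 ξ).source := by
      filter_upwards [hcproj, hsrc] with t ht hs
      exact mem_extChartAt_cotangent_source.2 (by rwa [ht])
    obtain ⟨h1, h2⟩ := curve_of_hasDerivAt_chart h0 hcs hfin
    refine ⟨h0, h1, h2.trans ?_⟩
    rw [translationField_eq ha]
    rfl
  · filter_upwards [extChartAt_target_mem_nhds (I := 𝓜) x] with q hq
    exact localTranslation_unit ha hq

end Translations

/-! ### Commuting local actions have commuting infinitesimal generators. -/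

section FlatCommute

variable {E : Type*} [NormedAddCommGroup E] [NormedSpace ℝ E] {m m' : E × E → E} {u₀ q₀ : E}

/-- Differentiate `m (u, m' (u', q₀)) = m' (u', m (u, q₀))` at `u₀`, in `u` along `X` and then in
`u'` along `Y`. This is the vanishing of the Lie bracket of the two generators at `q₀`. -/
theorem second_fderiv_of_commute (hm : ContDiffAt ℝ 2 m (u₀, q₀))
    (hm' : ContDiffAt ℝ 2 m' (u₀, q₀)) (h0 : m (u₀, q₀) = q₀) (h0' : m' (u₀, q₀) = q₀)
    (hcomm : ∀ᶠ z : E × E in 𝓝 (u₀, u₀), m (z.1, m' (z.2, q₀)) = m' (z.2, m (z.1, q₀)))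
    (X Y : E) :
    fderiv ℝ (fderiv ℝ m) (u₀, q₀) (X, 0) (0, fderiv ℝ m' (u₀, q₀) (Y, 0)) =
      fderiv ℝ (fderiv ℝ m') (u₀, q₀) (Y, 0) (0, fderiv ℝ m (u₀, q₀) (X, 0)) := by
  have hd := hm.differentiableAt two_ne_zero
  have hd' := hm'.differentiableAt two_ne_zero
  have hd2 : DifferentiableAt ℝ (fderiv ℝ m) (u₀, q₀) :=
    (hm.fderiv_right (m := 1) (by norm_num)).differentiableAt one_ne_zero
  have hd2' : DifferentiableAt ℝ (fderiv ℝ m') (u₀, q₀) :=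
    (hm'.fderiv_right (m := 1) (by norm_num)).differentiableAt one_ne_zero
  have hsymm := hm.isSymmSndFDerivAt (by simp)
  have hpair : HasFDerivAt (fun u' : E ↦ (u', q₀)) (ContinuousLinearMap.inl ℝ E E) u₀ :=
    hasFDerivAt_prodMk_left u₀ q₀
  have hF : HasFDerivAt (fun u' : E ↦ m' (u', q₀))
      ((fderiv ℝ m' (u₀, q₀)).comp (ContinuousLinearMap.inl ℝ E E)) u₀ :=
    hd'.hasFDerivAt.comp u₀ hpair
  have hG : HasFDerivAt (fun u' : E ↦ (u₀, m' (u', q₀)))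
      ((ContinuousLinearMap.inr ℝ E E).comp
        ((fderiv ℝ m' (u₀, q₀)).comp (ContinuousLinearMap.inl ℝ E E))) u₀ := by
    have := (hasFDerivAt_prodMk_right (𝕜 := ℝ) u₀ (m' (u₀, q₀))).comp u₀ hF
    exact this
  have hGc : Filter.Tendsto (fun u' : E ↦ (u₀, m' (u', q₀))) (𝓝 u₀) (𝓝 (u₀, q₀)) := by
    have := hG.continuousAt
    rwa [ContinuousAt, h0'] at this
  -- The first derivative is needed for all `u'` near `u₀`, since it is differentiated again in
  -- `u'`.
  have hev : ∀ᶠ u' in 𝓝 u₀, fderiv ℝ m (u₀, m' (u', q₀)) (X, 0) =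
      fderiv ℝ m' (u', q₀) (0, fderiv ℝ m (u₀, q₀) (X, 0)) := by
    have e1 := (hm.of_le one_le_two).eventually (by simp)
    have e2 := (hm'.of_le one_le_two).eventually (by simp)
    have hswap : ∀ᶠ z : E × E in 𝓝 (u₀, u₀),
        m (z.2, m' (z.1, q₀)) = m' (z.1, m (z.2, q₀)) :=
      (continuous_swap.tendsto (u₀, u₀)).eventually hcomm
    filter_upwards [hGc.eventually e1, hpair.continuousAt.eventually e2, hswap.curry_nhds]
      with u' h1 h2 h3
    have d1 : HasFDerivAt (fun u ↦ m (u, m' (u', q₀))) _ u₀ :=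
      (h1.differentiableAt one_ne_zero).hasFDerivAt.comp u₀ (hasFDerivAt_prodMk_left _ _)
    have d2 : HasFDerivAt (fun u ↦ m (u, q₀)) _ u₀ := hd.hasFDerivAt.comp u₀ hpair
    have d3 : HasFDerivAt (fun u ↦ (u', m (u, q₀))) _ u₀ :=
      (hasFDerivAt_prodMk_right (𝕜 := ℝ) u' (m (u₀, q₀))).comp u₀ d2
    have h2' : DifferentiableAt ℝ m' (u', m (u₀, q₀)) := by
      rw [h0]; exact h2.differentiableAt one_ne_zero
    have d4 : HasFDerivAt (fun u ↦ m' (u', m (u, q₀))) _ u₀ :=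
      HasFDerivAt.comp (g := m') u₀ h2'.hasFDerivAt d3
    have := DFunLike.congr_fun (d1.unique (d4.congr_of_eventuallyEq h3)) X
    simpa [h0] using this
  have hd2c : HasFDerivAt (fderiv ℝ m) (fderiv ℝ (fderiv ℝ m) (u₀, q₀)) (u₀, m' (u₀, q₀)) := by
    rw [h0']; exact hd2.hasFDerivAt
  have l1 : HasFDerivAt (fun u' ↦ fderiv ℝ m (u₀, m' (u', q₀))) _ u₀ :=
    HasFDerivAt.comp (g := fderiv ℝ m) u₀ hd2c hG
  have l2 := l1.clm_apply (hasFDerivAt_const ((X, 0) : E × E) u₀)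
  have r1 : HasFDerivAt (fun u' ↦ fderiv ℝ m' (u', q₀)) _ u₀ := hd2'.hasFDerivAt.comp u₀ hpair
  have r2 := r1.clm_apply
    (hasFDerivAt_const ((0, fderiv ℝ m (u₀, q₀) (X, 0)) : E × E) u₀)
  have hfin := DFunLike.congr_fun (l2.unique (r2.congr_of_eventuallyEq hev)) Y
  have hs := hsymm (X, 0) (0, fderiv ℝ m' (u₀, q₀) (Y, 0))
  rw [hs]
  simpa using hfin

end FlatCommute

/-! ### Commutation of the two translation fields, and smoothness of the Maurer-Cartan forms. -/

section TranslationForms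

variable {E : Type*} [NormedAddCommGroup E] [NormedSpace ℝ E]

local notation "𝓜" => modelWithCornersSelf ℝ E
local notation "𝓒" => cotModel (modelWithCornersSelf ℝ E)

variable {G : Type*} [TopologicalSpace G] [ChartedSpace E G] [Group G]
  [IsManifold 𝓘(ℝ, E) ∞ G] {a a' : G → G → G}

theorem fieldDeriv_translationField_of_commute (ha : IsSmoothTranslation E a)
    (ha' : IsSmoothTranslation E a') (hcomm : ∀ h k x, a h (a' k x) = a' k (a h x)) (x : G)
    (X Y : E) :
    fieldDeriv a x X (translationField (E := E) a' Y x) =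
      fieldDeriv a' x Y (translationField (E := E) a X x) := by
  have hx := mem_extChartAt_target (I := 𝓜) x
  have h1 := contDiffAt_localTranslation ha hx
  have h1' := contDiffAt_localTranslation ha' hx
  rw [translationField_eq ha, translationField_eq ha']
  refine second_fderiv_of_commute (h1.of_le ENat.LEInfty.out) (h1'.of_le ENat.LEInfty.out)
    (localTranslation_unit ha hx) (localTranslation_unit ha' hx) ?_ X Y
  have hev {b : G → G → G} (hb : IsSmoothTranslation E b) : ∀ᶠ u in 𝓝 (unitPoint E G),
      b ((extChartAt 𝓜 (1 : G)).symm u) x ∈ (extChartAt 𝓜 x).source := by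
    have hc : ContinuousAt (fun u ↦ b ((extChartAt 𝓜 (1 : G)).symm u) x) (unitPoint E G) :=
      (hb.mdifferentiable_left x _).continuousAt.comp (continuousAt_extChartAt_symm (1 : G))
    refine hc.preimage_mem_nhds ?_
    simp only [unitPoint, extChartAt_to_inv, hb.one_left]
    exact extChartAt_source_mem_nhds x
  filter_upwards [(continuous_fst.tendsto (unitPoint E G, unitPoint E G)).eventually (hev ha),
    (continuous_snd.tendsto (unitPoint E G, unitPoint E G)).eventually (hev ha')] with z hz hz'
  simp only [localTranslation, extChartAt_to_inv, (extChartAt 𝓜 x).left_inv hz,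
    (extChartAt 𝓜 x).left_inv hz', hcomm]

/-- The differential `D₁ m` at the unit of `a` read in the charts at `1` and `x₀`. -/
def localFrame (E : Type*) [NormedAddCommGroup E] [NormedSpace ℝ E]
    {G : Type*} [TopologicalSpace G] [ChartedSpace E G] [Group G] (a : G → G → G) (x₀ x : G) :
    E →L[ℝ] E :=
  (fderiv ℝ (localTranslation E a x₀) (unitPoint E G, extChartAt 𝓘(ℝ, E) x₀ x)).comp
    (ContinuousLinearMap.inl ℝ E E)

theorem mfderiv_chart_comp_translationMap (ha : IsSmoothTranslation E a) {x₀ x : G}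
    (hx : x ∈ (chartAt E x₀).source) :
    (mfderiv 𝓜 𝓜 (extChartAt 𝓜 x₀) x).comp (translationMap a x) = localFrame E a x₀ x :=
  ContinuousLinearMap.ext fun X ↦ mfderiv_chart_translationField ha hx X

omit [IsManifold 𝓘(ℝ, E) ∞ G] in
theorem isInvertible_translationMap (ha : IsSmoothTranslation E a) (x : G) :
    (translationMap (E := E) a x).IsInvertible :=
  ContinuousLinearMap.IsInvertible.of_inverse (translationMap_comp_translationForm ha x)
    (translationForm_comp_translationMap ha x)

theorem isInvertible_localFrame (ha : IsSmoothTranslation E a) {x₀ x : G}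
    (hx : x ∈ (chartAt E x₀).source) : (localFrame E a x₀ x).IsInvertible := by
  have := (isInvertible_mfderiv_extChartAt (I := 𝓜) (x := x₀) (y := x)
    (by rwa [extChartAt_source])).comp (isInvertible_translationMap ha x)
  rwa [mfderiv_chart_comp_translationMap ha hx] at this

/-- The form inverts `translationMap`, whose chart expression is `localFrame`; its smoothness thus
reduces to that of operator inversion. -/
theorem translationForm_eq (ha : IsSmoothTranslation E a) {x₀ x : G}
    (hx : x ∈ (chartAt E x₀).source) :
    translationForm a x =
      (localFrame E a x₀ x).inverse.comp (mfderiv 𝓜 𝓜 (extChartAt 𝓜 x₀) x) := by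
  ext v
  obtain ⟨e, he⟩ := isInvertible_localFrame ha hx
  have h1 := DFunLike.congr_fun (mfderiv_chart_comp_translationMap ha hx) (translationForm a x v)
  have h2 := DFunLike.congr_fun (translationMap_comp_translationForm ha x) v
  have h3 : (mfderiv 𝓜 𝓜 (extChartAt 𝓜 x₀) x v : E) = e (translationForm a x v) := by
    refine (congrArg (mfderiv 𝓜 𝓜 (extChartAt 𝓜 x₀) x) h2).symm.trans (h1.trans ?_)
    rw [← he]
    rfl
  rw [← he, ContinuousLinearMap.inverse_equiv]
  exact ((congrArg e.symm h3).trans (e.symm_apply_apply _)).symm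

theorem contMDiffAt_inverse_localFrame [CompleteSpace E] (ha : IsSmoothTranslation E a) (x₀ : G) :
    ContMDiffAt 𝓜 𝓘(ℝ, E →L[ℝ] E) ∞ (fun x ↦ (localFrame E a x₀ x).inverse) x₀ := by
  have h1 : ContMDiffAt 𝓜 𝓘(ℝ, E →L[ℝ] E) ∞ (localFrame E a x₀) x₀ :=
    (contMDiffAt_fderiv_localTranslation ha (x₀ := x₀)).clm_comp contMDiffAt_const
  exact ((isInvertible_localFrame ha (mem_chart_source E x₀)).contDiffAt_map_inverse
    ).contMDiffAt.comp x₀ h1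

/-- The component along `f` of the form `T_g(h ↦ a h g⁻¹)`. -/
def translationFormCoord (a : G → G → G) (f : GroupLieAlgebra 𝓜 G →L[ℝ] ℝ) (g : G) :
    TangentSpace 𝓜 g →L[ℝ] ℝ :=
  f.comp (translationForm a g)

theorem exists_contMDiffAt_pullbackForm_eq [CompleteSpace E] (ha : IsSmoothTranslation E a)
    (f : GroupLieAlgebra 𝓜 G →L[ℝ] ℝ) (ξ₀ : Cotangent 𝓜 G) :
    ∃ b : Cotangent 𝓜 G → ((E × (E →L[ℝ] ℝ)) →L[ℝ] ℝ),
      ContMDiffAt 𝓒 𝓘(ℝ, (E × (E →L[ℝ] ℝ)) →L[ℝ] ℝ) ∞ b ξ₀ ∧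
      ∀ ξ, ξ.proj ∈ (chartAt E ξ₀.proj).source → pullbackForm 𝓜 (translationFormCoord a f) ξ =
        (b ξ).comp (mfderiv 𝓒 𝓘(ℝ, E × (E →L[ℝ] ℝ)) (extChartAt 𝓒 ξ₀) ξ) := by
  let f' : E →L[ℝ] ℝ := f
  have h1 : ContMDiffAt 𝓒 𝓘(ℝ, E →L[ℝ] E) ∞
      (fun ξ : Cotangent 𝓜 G ↦ (localFrame E a ξ₀.proj ξ.proj).inverse) ξ₀ :=
    (contMDiffAt_inverse_localFrame ha ξ₀.proj).comp ξ₀ (Bundle.contMDiffAt_proj _)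
  have h2 : ContMDiffAt 𝓒 𝓘(ℝ, E →L[ℝ] ℝ) ∞
      (fun ξ : Cotangent 𝓜 G ↦ f'.comp (localFrame E a ξ₀.proj ξ.proj).inverse) ξ₀ :=
    contMDiffAt_const.clm_comp h1
  refine ⟨fun ξ ↦ (f'.comp (localFrame E a ξ₀.proj ξ.proj).inverse).comp
    (ContinuousLinearMap.fst ℝ E (E →L[ℝ] ℝ)), h2.clm_comp contMDiffAt_const, fun ξ hξ ↦ ?_⟩
  refine ContinuousLinearMap.ext fun v ↦ congrArg f' ?_
  rw [translationForm_eq ha hξ]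
  exact congrArg (localFrame E a ξ₀.proj ξ.proj).inverse (mfderiv_chart_tangentProj hξ v)

/-- The linear map `X ↦ fieldDeriv a x X v`. -/
def fieldDerivApply (a : G → G → G) (x : G) (v : E) : E →L[ℝ] E :=
  ((fderiv ℝ (fderiv ℝ (localTranslation E a x)) (unitPoint E G, extChartAt 𝓜 x x)).flip
    (0, v)).comp (ContinuousLinearMap.inl ℝ E E)

end TranslationForms

/-! ### Hamiltonian fields, their dual vertical fields and the bivector. -/

section Hamiltonian

variable {E : Type*} [NormedAddCommGroup E] [NormedSpace ℝ E] [FiniteDimensional ℝ E]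

local notation "𝓜" => modelWithCornersSelf ℝ E
local notation "𝓒" => cotModel (modelWithCornersSelf ℝ E)

section

variable {M : Type*} [TopologicalSpace M] [ChartedSpace E M] [IsManifold 𝓘(ℝ, E) ∞ M]

omit [FiniteDimensional ℝ E] in
theorem symplecticForm_self_apply (ξ : Cotangent 𝓜 M) (v w : TangentSpace 𝓒 ξ) :
    symplecticForm 𝓜 M ξ v w = (show E × (E →L[ℝ] ℝ) from v).2 (show E × (E →L[ℝ] ℝ) from w).1 -
      (show E × (E →L[ℝ] ℝ) from w).2 (show E × (E →L[ℝ] ℝ) from v).1 := by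
  rw [symplecticForm_self]
  rfl

omit [FiniteDimensional ℝ E] in
theorem symplecticForm_neg_swap (ξ : Cotangent 𝓜 M) (v w : TangentSpace 𝓒 ξ) :
    symplecticForm 𝓜 M ξ v w = -symplecticForm 𝓜 M ξ w v := by
  rw [symplecticForm_self_apply, symplecticForm_self_apply, neg_sub]

theorem neg_symplecticForm_symplecticDual_neg (ξ : Cotangent 𝓜 M)
    (β : TangentSpace 𝓒 ξ →L[ℝ] ℝ) :
    -(symplecticForm 𝓜 M ξ (symplecticDual 𝓜 ξ (-β))) = β := by
  rw [symplecticForm_symplecticDual, neg_neg]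

theorem isSmoothField_of_neg_symplecticForm_eq {V : Π ξ : Cotangent 𝓜 M, TangentSpace 𝓒 ξ}
    {β : Π ξ : Cotangent 𝓜 M, TangentSpace 𝓒 ξ →L[ℝ] ℝ}
    (hV : ∀ ξ, -(symplecticForm 𝓜 M ξ (V ξ)) = β ξ)
    (h : ∀ ξ₀ : Cotangent 𝓜 M, ∃ b : Cotangent 𝓜 M → ((E × (E →L[ℝ] ℝ)) →L[ℝ] ℝ),
      ContMDiffAt 𝓒 𝓘(ℝ, (E × (E →L[ℝ] ℝ)) →L[ℝ] ℝ) ∞ b ξ₀ ∧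
      ∀ ξ, ξ.proj ∈ (chartAt E ξ₀.proj).source → β ξ =
        (b ξ).comp (mfderiv 𝓒 𝓘(ℝ, E × (E →L[ℝ] ℝ)) (extChartAt 𝓒 ξ₀) ξ)) :
    IsSmoothField 𝓒 V := by
  refine isSmoothField_of_symplecticForm_eq fun ξ₀ ↦ ?_
  obtain ⟨b, hb, hβ⟩ := h ξ₀
  refine ⟨fun ξ ↦ -b ξ, hb.neg, fun ξ hξ ↦ ?_⟩
  rw [← neg_neg (symplecticForm 𝓜 M ξ (V ξ)), hV, hβ ξ hξ]
  rfl

omit [FiniteDimensional ℝ E] in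
-- A pulled back form kills vertical vectors `(0, f)`, while `ω(v, (0, f)) = -f(v₁)`; hence every
-- `f` vanishes on the base component `v₁`.
theorem tangentProj_eq_zero_of_neg_symplecticForm_eq {ξ : Cotangent 𝓜 M}
    {v : TangentSpace 𝓒 ξ} {α : Π x : M, TangentSpace 𝓜 x →L[ℝ] ℝ}
    (h : -(symplecticForm 𝓜 M ξ v) = pullbackForm 𝓜 α ξ) : tangentProj 𝓜 ξ v = 0 := by
  rw [tangentProj_apply]
  refine SeparatingDual.eq_zero_of_forall_dual_eq_zero (R := ℝ) (V := E) fun f ↦ ?_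
  have h1 := DFunLike.congr_fun h (show TangentSpace 𝓒 ξ from ((0 : E), f))
  have h2 := symplecticForm_self_apply ξ v (show TangentSpace 𝓒 ξ from ((0 : E), f))
  have h3 : pullbackForm 𝓜 α ξ (show TangentSpace 𝓒 ξ from ((0 : E), f)) = 0 := by
    refine (congrArg (α ξ.proj) (tangentProj_apply ξ _)).trans ?_
    exact (α ξ.proj).map_zero
  have h4 : -(symplecticForm 𝓜 M ξ v (show TangentSpace 𝓒 ξ from ((0 : E), f))) = 0 := h1.trans h3
  rw [h2] at h4
  simpa using h4

end

variable {G : Type*} [TopologicalSpace G] [ChartedSpace E G] [Group G] [T2Space G]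
  [IsManifold 𝓘(ℝ, E) ∞ G] {a a' : G → G → G}

theorem flowLift_translationField (ha : IsSmoothTranslation E a) (X : E) (ξ : Cotangent 𝓜 G) :
    (flowLift 𝓜 (translationField (E := E) a X) ξ : E × (E →L[ℝ] ℝ)) =
      (translationField (E := E) a X ξ.proj,
        -(ContinuousLinearMap.comp (show E →L[ℝ] ℝ from ξ.snd) (fieldDeriv a ξ.proj X))) :=
  have := FiniteDimensional.complete ℝ E
  (flowLift_translationField_aux ha X ξ).2.2

theorem hasFlowLift_translationField (ha : IsSmoothTranslation E a) (X : E) :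
    HasFlowLift 𝓜 (translationField (E := E) a X) := fun ξ ↦
  have := FiniteDimensional.complete ℝ E
  ⟨(flowLift_translationField_aux ha X ξ).1, (flowLift_translationField_aux ha X ξ).2.1⟩

theorem tangentProj_flowLift (ha : IsSmoothTranslation E a) (X : E) (ξ : Cotangent 𝓜 G) :
    tangentProj 𝓜 ξ (flowLift 𝓜 (translationField (E := E) a X) ξ) =
      translationField (E := E) a X ξ.proj :=
  (tangentProj_apply ξ _).trans (congrArg Prod.fst (flowLift_translationField ha X ξ))

theorem isHamiltonianFor_flowLift (ha : IsSmoothTranslation E a) (X : E) :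
    IsHamiltonianFor 𝓒 (symplecticForm 𝓜 G) (flowLift 𝓜 (translationField (E := E) a X))
      (momentFunction (E := E) a X) := by
  intro ξ
  refine ContinuousLinearMap.ext fun v ↦ ?_
  have h1 := symplecticForm_self_apply ξ (flowLift 𝓜 (translationField (E := E) a X) ξ) v
  have h2 := flowLift_translationField ha X ξ
  rw [differential_momentFunction ha]
  refine (congrArg Neg.neg h1).trans ?_
  rw [h2]
  simp
  rfl

theorem isSmoothField_flowLift (ha : IsSmoothTranslation E a) (X : E) :
    IsSmoothField 𝓒 (flowLift 𝓜 (translationField (E := E) a X) :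
      Π ξ : Cotangent 𝓜 G, TangentSpace 𝓒 ξ) := by
  refine isSmoothField_of_neg_symplecticForm_eq (isHamiltonianFor_flowLift ha X) fun ξ₀ ↦ ?_
  obtain ⟨b, hb, h⟩ := exists_contMDiffAt_differential_eq (contMDiff_momentFunction ha X) ξ₀
  refine ⟨b, hb, fun ξ hξ ↦ h ξ ?_⟩
  rw [← extChartAt_source 𝓒]
  exact mem_extChartAt_cotangent_source.2 hξ

/-- The vector field `Z` with `-i_Z ω` the pullback of the component along `f` of
`T_g(h ↦ a h g⁻¹)`. -/
def translationDual (a : G → G → G) (f : GroupLieAlgebra 𝓜 G →L[ℝ] ℝ) (ξ : Cotangent 𝓜 G) :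
    TangentSpace 𝓒 ξ :=
  symplecticDual 𝓜 ξ (-(pullbackForm 𝓜 (translationFormCoord a f) ξ))

omit [T2Space G] in
theorem neg_symplecticForm_translationDual (f : GroupLieAlgebra 𝓜 G →L[ℝ] ℝ)
    (ξ : Cotangent 𝓜 G) : -(symplecticForm 𝓜 G ξ (translationDual a f ξ)) =
      pullbackForm 𝓜 (translationFormCoord a f) ξ :=
  neg_symplecticForm_symplecticDual_neg ξ _

omit [T2Space G] in
theorem isSmoothField_translationDual (ha : IsSmoothTranslation E a)
    (f : GroupLieAlgebra 𝓜 G →L[ℝ] ℝ) : IsSmoothField 𝓒 (translationDual a f) :=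
  have := FiniteDimensional.complete ℝ E
  isSmoothField_of_neg_symplecticForm_eq (neg_symplecticForm_translationDual f)
    (exists_contMDiffAt_pullbackForm_eq ha f)

theorem symplecticForm_flowLift (ha : IsSmoothTranslation E a) (X : E) (ξ : Cotangent 𝓜 G)
    (u : TangentSpace 𝓒 ξ) :
    symplecticForm 𝓜 G ξ u (flowLift 𝓜 (translationField (E := E) a X) ξ) =
      (show E × (E →L[ℝ] ℝ) from u).2 (translationField (E := E) a X ξ.proj) +
      ξ.snd (fieldDeriv a ξ.proj X (tangentProj 𝓜 ξ u)) := by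
  rw [symplecticForm_neg_swap, tangentProj_apply, ← differential_momentFunction ha X ξ u]
  exact DFunLike.congr_fun (isHamiltonianFor_flowLift ha X ξ) u

/-- The pairing of `u` with the flow lift of the field of `Z` is linear in `Z`, so the sum is its
expansion at `Y` in the basis. -/
theorem sum_symplecticForm_flowLift_mul_coord (ha : IsSmoothTranslation E a) {n : ℕ}
    (X : Module.Basis (Fin n) ℝ (GroupLieAlgebra 𝓜 G)) (ξ : Cotangent 𝓜 G)
    (u : TangentSpace 𝓒 ξ) (Y : GroupLieAlgebra 𝓜 G) :
    ∑ i, symplecticForm 𝓜 G ξ u (flowLift 𝓜 (translationField a (X i)) ξ) * X.coord i Y =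
      (show E × (E →L[ℝ] ℝ) from u).2 (translationField a Y ξ.proj) +
      ξ.snd (fieldDeriv (E := E) a ξ.proj Y (tangentProj 𝓜 ξ u)) := by
  let p : E →L[ℝ] ℝ := ξ.snd
  let T : E →L[ℝ] E := translationMap a ξ.proj
  let u₂ : E →L[ℝ] ℝ := (show E × (E →L[ℝ] ℝ) from u).2
  let Φ : E →L[ℝ] ℝ := u₂.comp T +
    p.comp (fieldDerivApply a ξ.proj (tangentProj 𝓜 ξ u))
  let Ψ : GroupLieAlgebra 𝓜 G →L[ℝ] ℝ := Φ
  have h1 (Z : GroupLieAlgebra 𝓜 G) :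
      symplecticForm 𝓜 G ξ u (flowLift 𝓜 (translationField a Z) ξ) = Ψ Z :=
    symplecticForm_flowLift ha Z ξ u
  have h2 : Ψ Y = ∑ i, Ψ (X i) * X.coord i Y := by
    conv_lhs => rw [← X.sum_repr Y]
    rw [map_sum]
    refine Finset.sum_congr rfl fun i _ ↦ ?_
    rw [map_smul, smul_eq_mul, mul_comm]
    rfl
  simp only [h1]
  exact h2.symm

theorem sum_wedge_flowLift_translationDual (ha : IsSmoothTranslation E a) {n : ℕ}
    (X : Module.Basis (Fin n) ℝ (GroupLieAlgebra 𝓜 G)) (ξ : Cotangent 𝓜 G)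
    (v w : TangentSpace 𝓒 ξ) :
    ∑ i, wedge (flowLift 𝓜 (translationField a (X i)) ξ) (translationDual a (dualVector 𝓜 X i) ξ)
        (symplecticForm 𝓜 G ξ v) (symplecticForm 𝓜 G ξ w) =
      symplecticForm 𝓜 G ξ v w +
      ξ.snd (fieldDeriv (E := E) a ξ.proj (translationForm a ξ.proj (tangentProj 𝓜 ξ w))
        (tangentProj 𝓜 ξ v)) -
      ξ.snd (fieldDeriv (E := E) a ξ.proj (translationForm a ξ.proj (tangentProj 𝓜 ξ v))
        (tangentProj 𝓜 ξ w)) := by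
  have hZ (u : TangentSpace 𝓒 ξ) (i : Fin n) :
      symplecticForm 𝓜 G ξ u (translationDual a (dualVector 𝓜 X i) ξ) =
        X.coord i (translationForm a ξ.proj (tangentProj 𝓜 ξ u)) := by
    rw [symplecticForm_neg_swap]
    exact DFunLike.congr_fun (neg_symplecticForm_translationDual (dualVector 𝓜 X i) ξ) u
  have hS (u u' : TangentSpace 𝓒 ξ) :
      ∑ i, symplecticForm 𝓜 G ξ u (flowLift 𝓜 (translationField a (X i)) ξ) *
        symplecticForm 𝓜 G ξ u' (translationDual a (dualVector 𝓜 X i) ξ) =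
      (show E × (E →L[ℝ] ℝ) from u).2 (tangentProj 𝓜 ξ u') +
      ξ.snd (fieldDeriv (E := E) a ξ.proj (translationForm a ξ.proj (tangentProj 𝓜 ξ u'))
        (tangentProj 𝓜 ξ u)) := by
    have h1 := sum_symplecticForm_flowLift_mul_coord ha X ξ u
      (translationForm a ξ.proj (tangentProj 𝓜 ξ u'))
    have h2 : translationField a (translationForm a ξ.proj (tangentProj 𝓜 ξ u')) ξ.proj =
      tangentProj 𝓜 ξ u' := DFunLike.congr_fun (translationMap_comp_translationForm ha ξ.proj) _
    rw [h2] at h1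
    simp only [hZ]
    exact h1
  have e : symplecticForm 𝓜 G ξ v w =
      (show E × (E →L[ℝ] ℝ) from v).2 (tangentProj 𝓜 ξ w) -
        (show E × (E →L[ℝ] ℝ) from w).2 (tangentProj 𝓜 ξ v) := by
    rw [tangentProj_apply, tangentProj_apply]
    exact symplecticForm_self_apply ξ v w
  have hw : ∀ i, wedge (flowLift 𝓜 (translationField a (X i)) ξ)
      (translationDual a (dualVector 𝓜 X i) ξ) (symplecticForm 𝓜 G ξ v) (symplecticForm 𝓜 G ξ w) =
      symplecticForm 𝓜 G ξ v (flowLift 𝓜 (translationField a (X i)) ξ) *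
        symplecticForm 𝓜 G ξ w (translationDual a (dualVector 𝓜 X i) ξ) -
      symplecticForm 𝓜 G ξ w (flowLift 𝓜 (translationField a (X i)) ξ) *
        symplecticForm 𝓜 G ξ v (translationDual a (dualVector 𝓜 X i) ξ) := fun i ↦ by
    rw [wedge, mul_comm (symplecticForm 𝓜 G ξ v (translationDual a (dualVector 𝓜 X i) ξ))]
  rw [Finset.sum_congr rfl fun i _ ↦ hw i, Finset.sum_sub_distrib]
  have h1 := hS v w
  have h2 := hS w v
  linarith

theorem poissonBivector_eq (ha : IsSmoothTranslation E a) (ha' : IsSmoothTranslation E a')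
    (hcomm : ∀ h k x, a h (a' k x) = a' k (a h x)) {n : ℕ}
    (X : Module.Basis (Fin n) ℝ (GroupLieAlgebra 𝓜 G)) (ξ : Cotangent 𝓜 G)
    (α β : TangentSpace 𝓒 ξ →L[ℝ] ℝ) :
    poissonBivector 𝓜 ξ α β = (1 / 2 : ℝ) * ∑ i,
      (wedge (flowLift 𝓜 (translationField a' (X i)) ξ)
          (translationDual a' (dualVector 𝓜 X i) ξ) α β +
        wedge (flowLift 𝓜 (translationField a (X i)) ξ)
          (translationDual a (dualVector 𝓜 X i) ξ) α β) := by
  have key (v w : TangentSpace 𝓜 ξ.proj) :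
      fieldDeriv (E := E) a ξ.proj (translationForm a ξ.proj v) w =
        fieldDeriv (E := E) a' ξ.proj (translationForm a' ξ.proj w) v := by
    have h1 := fieldDeriv_translationField_of_commute ha ha' hcomm ξ.proj
      (translationForm a ξ.proj v) (translationForm a' ξ.proj w)
    have h2 : translationField a (translationForm a ξ.proj v) ξ.proj = v :=
      DFunLike.congr_fun (translationMap_comp_translationForm ha ξ.proj) v
    have h3 : translationField a' (translationForm a' ξ.proj w) ξ.proj = w :=
      DFunLike.congr_fun (translationMap_comp_translationForm ha' ξ.proj) w
    rwa [h2, h3] at h1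
  have h1 := sum_wedge_flowLift_translationDual ha X ξ (symplecticDual 𝓜 ξ α)
    (symplecticDual 𝓜 ξ β)
  have h2 := sum_wedge_flowLift_translationDual ha' X ξ (symplecticDual 𝓜 ξ α)
    (symplecticDual 𝓜 ξ β)
  -- Commutation turns the two correction terms of `a` into those of `a'` with opposite signs, so
  -- they cancel when `h1` and `h2` are added.
  rw [key, key] at h1
  rw [symplecticForm_symplecticDual, symplecticForm_symplecticDual] at h1 h2
  rw [Finset.sum_add_distrib, h1, h2, poissonBivector, symplecticForm_symplecticDual]
  ring

end Hamiltonian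

/-! ### The two multiplications of a Lie group. -/

section LieGroup

variable {E : Type*} [NormedAddCommGroup E] [NormedSpace ℝ E]
  {G : Type*} [TopologicalSpace G] [ChartedSpace E G] [Group G] [LieGroup 𝓘(ℝ, E) ∞ G]

theorem isSmoothTranslation_mul : IsSmoothTranslation E (fun h x : G ↦ h * x) where
  contMDiff := contMDiff_mul 𝓘(ℝ, E) ∞
  one_left := one_mul
  one_right := mul_one
  assoc h k x := (mul_assoc h k x).symm
  self_inv := mul_inv_cancel
  inv_self := inv_mul_cancel

theorem isSmoothTranslation_mul_swap : IsSmoothTranslation E (fun h x : G ↦ x * h) where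
  contMDiff := contMDiff_snd.mul contMDiff_fst
  one_left := mul_one
  one_right := one_mul
  assoc h k x := mul_assoc x k h
  self_inv := inv_mul_cancel
  inv_self := mul_inv_cancel

variable [FiniteDimensional ℝ E] [T2Space G] {n : ℕ}
  (X : Module.Basis (Fin n) ℝ (GroupLieAlgebra 𝓘(ℝ, E) G)) (j : Fin n)

omit [FiniteDimensional ℝ E] [T2Space G] in
theorem leftMomentCoord_eq :
    leftMomentCoord 𝓘(ℝ, E) X j = momentFunction (E := E) (fun h x : G ↦ h * x) (X j) :=
  funext fun ξ ↦ congrArg ξ.snd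
    (DFunLike.congr_fun (inverse_translationForm isSmoothTranslation_mul ξ.proj) (X j))

omit [FiniteDimensional ℝ E] [T2Space G] in
theorem rightMomentCoord_eq :
    rightMomentCoord 𝓘(ℝ, E) X j = momentFunction (E := E) (fun h x : G ↦ x * h) (X j) :=
  funext fun ξ ↦ congrArg ξ.snd
    (DFunLike.congr_fun (inverse_translationForm isSmoothTranslation_mul_swap ξ.proj) (X j))

end LieGroup

end CotangentPoisson

end

theorem mainTheorem2
    {E : Type*} [NormedAddCommGroup E] [NormedSpace ℝ E] [FiniteDimensional ℝ E]
    {G : Type*} [TopologicalSpace G] [T2Space G] [ChartedSpace E G] [Group G]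
    [LieGroup 𝓘(ℝ, E) ∞ G]
    {n : ℕ} (X : Module.Basis (Fin n) ℝ (GroupLieAlgebra 𝓘(ℝ, E) G)) :
    -- the canonical 2-form is nondegenerate
    (∀ ξ : Cotangent 𝓘(ℝ, E) G, (symplecticForm 𝓘(ℝ, E) G ξ).IsInvertible) ∧
    -- the moment functions are smooth
    (∀ j, ContMDiff (cotModel 𝓘(ℝ, E)) 𝓘(ℝ, ℝ) ∞ (leftMomentCoord 𝓘(ℝ, E) X j) ∧
      ContMDiff (cotModel 𝓘(ℝ, E)) 𝓘(ℝ, ℝ) ∞ (rightMomentCoord 𝓘(ℝ, E) X j)) ∧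
    -- the flow lifts exist, are smooth vector fields, and project onto the given fields
    (∀ j, HasFlowLift 𝓘(ℝ, E) (leftField 𝓘(ℝ, E) (X j)) ∧
      HasFlowLift 𝓘(ℝ, E) (rightField 𝓘(ℝ, E) (X j))) ∧
    (∀ j, IsSmoothField (cotModel 𝓘(ℝ, E)) (leftLift 𝓘(ℝ, E) X j) ∧
      IsSmoothField (cotModel 𝓘(ℝ, E)) (rightLift 𝓘(ℝ, E) X j)) ∧
    (∀ j ξ, tangentProj 𝓘(ℝ, E) ξ (leftLift 𝓘(ℝ, E) X j ξ) =
        leftField 𝓘(ℝ, E) (X j) ξ.proj ∧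
      tangentProj 𝓘(ℝ, E) ξ (rightLift 𝓘(ℝ, E) X j ξ) =
        rightField 𝓘(ℝ, E) (X j) ξ.proj) ∧
    -- the flow lifts are Hamiltonian
    (∀ j, IsHamiltonianFor (cotModel 𝓘(ℝ, E)) (symplecticForm 𝓘(ℝ, E) G)
        (leftLift 𝓘(ℝ, E) X j) (rightMomentCoord 𝓘(ℝ, E) X j) ∧
      IsHamiltonianFor (cotModel 𝓘(ℝ, E)) (symplecticForm 𝓘(ℝ, E) G)
        (rightLift 𝓘(ℝ, E) X j) (leftMomentCoord 𝓘(ℝ, E) X j)) ∧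
    -- the dual fields satisfy their defining equations, are smooth, and are vertical
    (∀ j ξ, -(symplecticForm 𝓘(ℝ, E) G ξ (leftDualField 𝓘(ℝ, E) X j ξ)) =
        pullbackForm 𝓘(ℝ, E) (leftMaurerCartanCoord 𝓘(ℝ, E) X j) ξ ∧
      -(symplecticForm 𝓘(ℝ, E) G ξ (rightDualField 𝓘(ℝ, E) X j ξ)) =
        pullbackForm 𝓘(ℝ, E) (rightMaurerCartanCoord 𝓘(ℝ, E) X j) ξ) ∧
    (∀ j, IsSmoothField (cotModel 𝓘(ℝ, E)) (leftDualField 𝓘(ℝ, E) X j) ∧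
      IsSmoothField (cotModel 𝓘(ℝ, E)) (rightDualField 𝓘(ℝ, E) X j)) ∧
    (∀ j ξ, tangentProj 𝓘(ℝ, E) ξ (leftDualField 𝓘(ℝ, E) X j ξ) = 0 ∧
      tangentProj 𝓘(ℝ, E) ξ (rightDualField 𝓘(ℝ, E) X j ξ) = 0) ∧
    -- the formula for the Poisson bivector
    (∀ (ξ : Cotangent 𝓘(ℝ, E) G)
        (α β : TangentSpace (cotModel 𝓘(ℝ, E)) ξ →L[ℝ] ℝ),
      poissonBivector 𝓘(ℝ, E) ξ α β =
        (1 / 2 : ℝ) * ∑ i,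
          (wedge (rightLift 𝓘(ℝ, E) X i ξ) (rightDualField 𝓘(ℝ, E) X i ξ) α β +
            wedge (leftLift 𝓘(ℝ, E) X i ξ) (leftDualField 𝓘(ℝ, E) X i ξ) α β)) := by
  have : IsManifold 𝓘(ℝ, E) ∞ G := ContMDiffMul.toIsManifold
  -- The names refer to the invariant fields: moving `h` in `h * x` gives the right invariant ones,
  -- moving it in `x * h` the left invariant ones.
  have hr : IsSmoothTranslation E (fun h x : G ↦ h * x) := isSmoothTranslation_mul
  have hl : IsSmoothTranslation E (fun h x : G ↦ x * h) := isSmoothTranslation_mul_swap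
  simp only [leftMomentCoord_eq, rightMomentCoord_eq]
  exact ⟨isInvertible_symplecticForm,
    fun j ↦ ⟨contMDiff_momentFunction hr (X j), contMDiff_momentFunction hl (X j)⟩,
    fun j ↦ ⟨hasFlowLift_translationField hl (X j), hasFlowLift_translationField hr (X j)⟩,
    fun j ↦ ⟨isSmoothField_flowLift hl (X j), isSmoothField_flowLift hr (X j)⟩,
    fun j ξ ↦ ⟨tangentProj_flowLift hl (X j) ξ, tangentProj_flowLift hr (X j) ξ⟩,
    fun j ↦ ⟨isHamiltonianFor_flowLift hl (X j), isHamiltonianFor_flowLift hr (X j)⟩,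
    fun j ξ ↦ ⟨neg_symplecticForm_symplecticDual_neg ξ _,
      neg_symplecticForm_symplecticDual_neg ξ _⟩,
    fun j ↦ ⟨isSmoothField_translationDual hl (dualVector 𝓘(ℝ, E) X j),
      isSmoothField_translationDual hr (dualVector 𝓘(ℝ, E) X j)⟩,
    fun j ξ ↦
      ⟨tangentProj_eq_zero_of_neg_symplecticForm_eq (neg_symplecticForm_symplecticDual_neg ξ _),
      tangentProj_eq_zero_of_neg_symplecticForm_eq (neg_symplecticForm_symplecticDual_neg ξ _)⟩,
    fun ξ α β ↦ poissonBivector_eq hl hr (fun h k x ↦ mul_assoc k x h) X ξ α β⟩
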